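/- **Billingsley's theorem.** For a positive integer $m$ let $P_i(m)$ be the $i$-th largest prime factor of $m$, counted with multiplicity, with $P_i(m)=1$ if $m$ has fewer than $i$ prime factors. For $n\ge 1$ let $N$ be uniformly distributed on $\{1,\dots,n\}$ and put $L_i(n)=\log P_i(N)/\log n$ for $i\ge 1$ (set $L_i(1)=0$, which does not affect the limits). Let $\rho$ be the Dickman function, i.e. the unique continuous function on $[0,\infty)$ with $\rho(u)=1$ for $0\le u\le 1$ and $\rho(u)=\rho(v)-\int_v^u\rho(t-1)\,\frac{dt}{t}$ for $0\le u-1\le v\le u$ (with $\rho(s):=0$ for $s<0$). For $k\ge 1$ define $$f_k(t_1,\dots,t_k)=\frac{1}{t_1\cdots t_k}\,\rho\!\left(\frac{1-(t_1+\dots+t_k)}{t_k}\right)$$ if $t_1>\dots>t_k>0$ and $t_1+\dots+t_k<1$, and $f_k=0$ elsewhere. There is exactly one probability measure on $\mathbb{R}^\infty$ which is concentrated on the simplex $\{x:\ x_1,x_2,\dots\ge 0,\ x_1+x_2+\dots=1\}$ and whose image under the projection to the first $k$ coordinates has density $f_k$ with respect to Lebesgue measure on $\mathbb{R}^k$, for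 every $k\ge 1$; this is the Poisson–Dirichlet distribution with parameter $1$. Let $(L_1,L_2,\dots)$ be a random sequence with this distribution. Then, as $n\to\infty$, $$(L_1(n),L_2(n),\dots)\Rightarrow(L_1,L_2,\dots)$$ in distribution in $\mathbb{R}^\infty$ with the product topology, and, for every $k\ge 1$, $$(L_1(n),\dots,L_k(n))\Rightarrow(L_1,\dots,L_k)$$ in distribution in $\mathbb{R}^k$, where the limit has density $f_k$. -/

import Mathlib

open MeasureTheory ProbabilityTheory Filter Topology

noncomputable section

namespace Billingsley

/-- The characterization of the Dickman function: it is continuous on `[0, ∞)`, equal to `1` on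
`[0, 1]`, and satisfies `ρ u = ρ v - ∫ t in v..u, ρ (t - 1) / t` for `0 ≤ u - 1 ≤ v ≤ u`.
The usual convention `ρ = 0` on `(-∞, 0)` gives `ρ (t - 1)` its meaning for `t < 1`. -/
structure IsDickman (ρ : ℝ → ℝ) : Prop where
  eq_zero : ∀ u < 0, ρ u = 0
  eq_one : ∀ u ∈ Set.Icc (0 : ℝ) 1, ρ u = 1
  continuousOn : ContinuousOn ρ (Set.Ici 0)
  recursion : ∀ u v : ℝ, 0 ≤ u - 1 → u - 1 ≤ v → v ≤ u →
    ρ u = ρ v - ∫ t in v..u, ρ (t - 1) / t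

/-- Successive approximations to the Dickman function; the `n`-th one is correct on
`[0, n + 1]`. -/
def dickmanApprox : ℕ → ℝ → ℝ
  | 0, _ => 1
  | n + 1, u => 1 - ∫ t in (1 : ℝ)..max u 1, dickmanApprox n (t - 1) / t

/-- The Dickman function `ρ`, extended by `0` to negative arguments. -/
def dickman (u : ℝ) : ℝ := if u < 0 then 0 else dickmanApprox ⌈u⌉₊ u

theorem continuous_dickmanApprox (n : ℕ) : Continuous (dickmanApprox n) := by
  induction n with
  | zero => exact continuous_const
  | succ n ih =>
    have h : ∀ u : ℝ, dickmanApprox (n + 1) u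
        = 1 - ∫ t in (1 : ℝ)..max u 1, dickmanApprox n (t - 1) / max t 1 := by
      intro u
      simp only [dickmanApprox]
      congr 1
      apply intervalIntegral.integral_congr
      intro t ht
      rw [Set.uIcc_of_le (le_max_right _ _)] at ht
      simp only
      rw [max_eq_left ht.1]
    have hg : Continuous (fun t : ℝ => dickmanApprox n (t - 1) / max t 1) := by
      refine (ih.comp (by fun_prop)).div (by fun_prop) ?_
      intro t
      have : (1 : ℝ) ≤ max t 1 := le_max_right _ _
      positivity
    have h2 : Continuous (fun u : ℝ => ∫ t in (1 : ℝ)..u, dickmanApprox n (t - 1) / max t 1) :=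
      intervalIntegral.continuous_primitive (fun a b => hg.intervalIntegrable a b) 1
    have h3 : dickmanApprox (n + 1) = fun u => 1 -
        (fun u : ℝ => ∫ t in (1 : ℝ)..u, dickmanApprox n (t - 1) / max t 1) (max u 1) := by
      funext u; exact h u
    rw [h3]
    exact continuous_const.sub (h2.comp (by fun_prop))

theorem dickmanApprox_succ_eq (n : ℕ) :
    ∀ u ≤ (n : ℝ) + 1, dickmanApprox (n + 1) u = dickmanApprox n u := by
  induction n with
  | zero =>
    intro u hu
    simp only [dickmanApprox]
    rw [max_eq_right (by simpa using hu)]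
    simp
  | succ n ih =>
    intro u hu
    rw [dickmanApprox, dickmanApprox]
    congr 1
    apply intervalIntegral.integral_congr
    intro t ht
    rw [Set.uIcc_of_le (le_max_right _ _)] at ht
    have h1 : t ≤ (n : ℝ) + 1 + 1 := by
      refine ht.2.trans (max_le (by exact_mod_cast hu) ?_)
      have : (0 : ℝ) ≤ n := Nat.cast_nonneg n
      linarith
    simp only
    rw [ih (t - 1) (by linarith)]

theorem dickman_eq_approx (n : ℕ) (u : ℝ) (hu0 : 0 ≤ u) (hu : u ≤ (n : ℝ) + 1) :
    dickman u = dickmanApprox n u := by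
  have key : ∀ m k : ℕ, u ≤ (m : ℝ) + 1 → dickmanApprox (m + k) u = dickmanApprox m u := by
    intro m k hm
    induction k with
    | zero => rfl
    | succ k ih =>
      rw [← add_assoc, dickmanApprox_succ_eq (m + k) u ?_, ih]
      push_cast
      have : (0 : ℝ) ≤ k := Nat.cast_nonneg k
      linarith
  rw [dickman, if_neg (not_lt.mpr hu0)]
  have hc : u ≤ (⌈u⌉₊ : ℝ) + 1 := (Nat.le_ceil u).trans (by linarith)
  rw [← key ⌈u⌉₊ n hc, add_comm, key n ⌈u⌉₊ hu]

theorem dickman_of_one_le (u : ℝ) (hu : 1 ≤ u) :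
    dickman u = 1 - ∫ t in (1 : ℝ)..u, dickman (t - 1) / t := by
  obtain ⟨n, hn⟩ := exists_nat_ge u
  rw [dickman_eq_approx (n + 1) u (by linarith) (by push_cast; linarith), dickmanApprox,
    max_eq_left hu]
  congr 1
  apply intervalIntegral.integral_congr
  intro t ht
  rw [Set.uIcc_of_le hu] at ht
  simp only
  rw [dickman_eq_approx n (t - 1) (by linarith [ht.1]) (by linarith [ht.2])]

theorem dickman_of_le_one (u : ℝ) (hu0 : 0 ≤ u) (hu : u ≤ 1) : dickman u = 1 := by
  rw [dickman_eq_approx 0 u hu0 (by simpa using hu)]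
  rfl

theorem continuousOn_dickman : ContinuousOn dickman (Set.Ici 0) := by
  intro u hu
  obtain ⟨n, hn⟩ := exists_nat_ge u
  refine ((continuous_dickmanApprox n).continuousWithinAt (s := Set.Ici 0)
    (x := u)).congr_of_eventuallyEq ?_ (dickman_eq_approx n u hu (by linarith))
  have h1 : ∀ᶠ x in 𝓝[Set.Ici 0] u, x < (n : ℝ) + 1 :=
    mem_nhdsWithin_of_mem_nhds (Iio_mem_nhds (by linarith))
  filter_upwards [h1, self_mem_nhdsWithin] with x hx hx0
  exact dickman_eq_approx n x hx0 hx.le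

theorem isDickman_dickman : IsDickman dickman where
  eq_zero u hu := by rw [dickman, if_pos hu]
  eq_one u hu := dickman_of_le_one u hu.1 hu.2
  continuousOn := continuousOn_dickman
  recursion := by
    have hint : ∀ a b : ℝ, 1 ≤ a → 1 ≤ b →
        IntervalIntegrable (fun t : ℝ => dickman (t - 1) / t) volume a b := by
      intro a b ha hb
      apply ContinuousOn.intervalIntegrable
      have hsub : ∀ t ∈ Set.uIcc a b, 1 ≤ t := fun t ht => (le_min ha hb).trans ht.1
      refine ContinuousOn.div (continuousOn_dickman.comp (by fun_prop) ?_) continuousOn_id ?_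
      · intro t ht
        have := hsub t ht
        simp only [Set.mem_Ici]
        linarith
      · intro t ht
        exact (zero_lt_one.trans_le (hsub t ht)).ne'
    intro u v hu huv hvu
    have hu1 : 1 ≤ u := by linarith
    have hv0 : 0 ≤ v := hu.trans huv
    rcases le_total 1 v with hv | hv
    · rw [dickman_of_one_le u hu1, dickman_of_one_le v hv,
        ← intervalIntegral.integral_add_adjacent_intervals (hint 1 v le_rfl hv) (hint v u hv hu1)]
      ring
    · have hz : ∀ᵐ t ∂(volume : Measure ℝ), t ∈ Set.uIoc v 1 → dickman (t - 1) / t = 0 := by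
        have : ∀ᵐ t ∂(volume : Measure ℝ), t ≠ 1 := by
          simp [ae_iff]
        filter_upwards [this] with t ht1 ht
        rw [Set.uIoc_of_le hv] at ht
        have hlt : t - 1 < 0 := by
          have := lt_of_le_of_ne ht.2 ht1
          linarith
        rw [dickman, if_pos hlt, zero_div]
      have hi : IntervalIntegrable (fun t : ℝ => dickman (t - 1) / t) volume v 1 := by
        refine (intervalIntegrable_const (c := (0 : ℝ))).congr_ae ?_
        rw [Filter.EventuallyEq, ae_restrict_iff' measurableSet_uIoc]
        filter_upwards [hz] with t ht h using (ht h).symm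
      rw [dickman_of_one_le u hu1, dickman_of_le_one v hv0 hv,
        ← intervalIntegral.integral_add_adjacent_intervals hi (hint 1 u le_rfl hu1),
        intervalIntegral.integral_congr_ae hz]
      simp

theorem IsDickman.eq_dickman {ρ : ℝ → ℝ} (h : IsDickman ρ) : ρ = dickman := by
  have key : ∀ n : ℕ, ∀ u ≤ (n : ℝ) + 1, ρ u = dickman u := by
    intro n
    induction n with
    | zero =>
      intro u hu
      rcases lt_or_ge u 0 with h0 | h0
      · rw [h.eq_zero u h0, isDickman_dickman.eq_zero u h0]
      · have hu' : u ∈ Set.Icc (0 : ℝ) 1 := ⟨h0, by simpa using hu⟩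
        rw [h.eq_one u hu', isDickman_dickman.eq_one u hu']
    | succ n ih =>
      intro u hu
      push_cast at hu
      rcases le_total u ((n : ℝ) + 1) with h1 | h1
      · exact ih u h1
      · have h0 : (0 : ℝ) ≤ n := Nat.cast_nonneg n
        rw [h.recursion u (n + 1) (by linarith) (by linarith) h1,
          isDickman_dickman.recursion u (n + 1) (by linarith) (by linarith) h1, ih _ le_rfl]
        congr 1
        apply intervalIntegral.integral_congr
        intro t ht
        rw [Set.uIcc_of_le h1] at ht
        simp only
        rw [ih (t - 1) (by linarith [ht.2])]
  funext u
  obtain ⟨n, hn⟩ := exists_nat_ge u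
  exact key n u (by linarith)

/-- The open set `U ⊆ ℝ^(k+1)` of points with `t₁ > ⋯ > tₖ₊₁ > 0` and `t₁ + ⋯ + tₖ₊₁ < 1`. -/
def pdSupport (k : ℕ) : Set (Fin (k + 1) → ℝ) :=
  {t | StrictAnti t ∧ 0 < t (Fin.last k) ∧ ∑ i, t i < 1}

open Classical in
/-- The density on `ℝ^(k+1)` of the first `k + 1` coordinates of a Poisson-Dirichlet point. -/
def pdDensity (k : ℕ) (t : Fin (k + 1) → ℝ) : ℝ :=
  if t ∈ pdSupport k then
    (1 / ∏ i, t i) * dickman ((1 - ∑ i, t i) / t (Fin.last k))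
  else 0

/-- The projection of `ℝ^∞` onto its first `k + 1` coordinates. -/
def firstCoords (k : ℕ) (x : ℕ → ℝ) : Fin (k + 1) → ℝ := fun i => x i

/-- The infinite-dimensional simplex. -/
def simplex : Set (ℕ → ℝ) := {x | (∀ i, 0 ≤ x i) ∧ HasSum x 1}

/-- `μ` is the Poisson-Dirichlet distribution with parameter `1`: the law of a random point of the
simplex whose first `k + 1` coordinates have joint density `pdDensity k`, for every `k`. -/
structure IsPoissonDirichlet (μ : ProbabilityMeasure (ℕ → ℝ)) : Prop where
  mem_simplex : ∀ᵐ x ∂(μ : Measure (ℕ → ℝ)), x ∈ simplex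
  density : ∀ k : ℕ, (μ : Measure (ℕ → ℝ)).map (firstCoords k) =
    (volume : Measure (Fin (k + 1) → ℝ)).withDensity fun t => ENNReal.ofReal (pdDensity k t)

/-- The `(i + 1)`-st largest prime factor of `m`, counted with multiplicity, and `1` when `m` has
at most `i` prime factors. -/
def largestPrimeFactor (i m : ℕ) : ℕ := m.primeFactorsList.reverse.getD i 1

/-- The sequence `(L₁(n), L₂(n), …)` as a function of the integer `m`, the value of `N`. -/
def logPrimeFactors (n : ℕ+) (m : ℕ) : ℕ → ℝ :=
  fun i => Real.log (largestPrimeFactor i m) / Real.log (n : ℕ)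

/-- The law of an integer `N` chosen uniformly from `1` to `n`. -/
def uniformUpTo (n : ℕ+) : Measure ℕ := uniformOn (Set.Icc 1 (n : ℕ))

instance isProbabilityMeasure_uniformUpTo (n : ℕ+) : IsProbabilityMeasure (uniformUpTo n) :=
  isProbabilityMeasure_uniformOn (Set.finite_Icc _ _) ⟨1, le_rfl, n.2⟩

end Billingsley

end

namespace Billingsley

/-! Picking prime factors with probability proportional to `log p` makes the limit law elementary.
For a law `μ` of sequences, `sizeBiased μ k` sums, over injective choices of `k` places, the law of
the chosen points weighted by their product. In the limit this turns out to be Lebesgue measure on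
`tupleSimplex k`, and this fact alone forces the Poisson-Dirichlet densities.

Lower bound: for disjoint windows `[a i, b i]` with `∑ b i < 1`, the proportion of integers
divisible by `p₁ ⋯ pₖ` is nearly `1 / (p₁ ⋯ pₖ)`, so Mertens' first theorem bounds the mean weighted
number of tuples below by about `∏ (b i - a i)`. Passing to a limit law and using a Vitali covering
gives `restrict_le_sizeBiased`. No matching sieve upper bound is required. The points have total
mass at most `1`, so after `k` picks the next one has mass at most `1 - ∑ t i`, and integrating this
over the simplex gives exactly the volume of the next simplex. Hence equality, by induction on `k`
(`sizeBiased_eq_restrict`).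

Equality implies that almost surely the points are positive, distinct and sum to `1`. To isolate the
largest points, either no unchosen point exceeds a threshold, or the largest unchosen one does
(`topIndicator_add_tsum`). The Dickman function obeys the same dichotomy in integrated form
(`lintegral_dickman_add`), and an induction matches the two (`lintegral_tsum_topIndicator`).

All the laws live on the compact set `sortedSimplex`, so every ultrafilter has a limit law. Each
such limit along an ultrafilter finer than `atTop` is Poisson-Dirichlet, and finite-dimensional
marginals determine a law; so the limits coincide, which gives existence and convergence together.
-/

/-! ### Mertens' first theorem -/

/-- The sum `∑ log p / p` over the primes `p ≤ N`. -/
noncomputable def mertensSum (N : ℕ) : ℝ := ∑ p ∈ N.primesLE, Real.log p / p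

theorem log_factorial_eq_sum_primesLE (N : ℕ) :
    Real.log (N.factorial) =
      ∑ p ∈ N.primesLE, (N.factorial.factorization p : ℝ) * Real.log p := by
  rw [Real.log_nat_eq_sum_factorization, Finsupp.sum]
  refine Finset.sum_subset ?_ ?_
  · intro p hp
    rw [Nat.support_factorization, Nat.mem_primeFactors] at hp
    exact Nat.mem_primesLE.mpr ⟨(hp.1.dvd_factorial).mp hp.2.1, hp.1⟩
  · intro p _ hp
    rw [Finsupp.notMem_support_iff] at hp
    simp [hp]

theorem div_le_factorization_factorial {p : ℕ} (hp : p.Prime) (N : ℕ) :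
    N / p ≤ N.factorial.factorization p := by
  rw [Nat.factorization_factorial hp (b := Nat.log p N + 2) (by omega)]
  calc N / p = N / p ^ 1 := by rw [pow_one]
    _ ≤ _ := Finset.single_le_sum (f := fun i => N / p ^ i) (fun _ _ => Nat.zero_le _)
      (by simp)

/-- The exponent of `p` in `N!` is at least `N / p - 1`. Compare with `log N! ≤ N log N`; the loss
from the `-1` is Chebyshev's `θ(N) ≤ N log 4`. -/
theorem mertensSum_le {N : ℕ} (hN : 0 < N) : mertensSum N ≤ Real.log N + Real.log 4 := by
  have hN' : (0 : ℝ) < N := by exact_mod_cast hN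
  have h1 : (N : ℝ) * mertensSum N - Chebyshev.theta N ≤ Real.log N.factorial := by
    rw [log_factorial_eq_sum_primesLE, Chebyshev.theta_eq_sum_primesLE_log, mertensSum,
      Finset.mul_sum, ← Finset.sum_sub_distrib]
    refine Finset.sum_le_sum fun p hp => ?_
    have hp' := Nat.prime_of_mem_primesLE hp
    have hlog : 0 ≤ Real.log p := Real.log_natCast_nonneg p
    have h2 : (N : ℝ) / p - 1 ≤ (N.factorial.factorization p : ℝ) := by
      refine le_trans ?_ (Nat.cast_le.mpr (div_le_factorization_factorial hp' N))
      rw [← Nat.floor_div_eq_div (K := ℝ)]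
      exact (Nat.sub_one_lt_floor _).le
    calc (N : ℝ) * (Real.log p / p) - Real.log p = ((N : ℝ) / p - 1) * Real.log p := by ring
      _ ≤ _ := mul_le_mul_of_nonneg_right h2 hlog
  have h3 : Real.log N.factorial ≤ N * Real.log N := by
    rw [← Real.log_pow]
    refine Real.log_le_log (by exact_mod_cast Nat.factorial_pos N) ?_
    exact_mod_cast Nat.factorial_le_pow N
  have h4 := Chebyshev.theta_le_log4_mul_x (x := N) hN'.le
  have : (N : ℝ) * mertensSum N ≤ N * (Real.log N + Real.log 4) := by linarith
  exact le_of_mul_le_mul_left this hN'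

theorem summable_log_div_mul_sub_one :
    Summable fun p : ℕ => Real.log p / (p * (p - 1)) := by
  have hs : Summable fun p : ℕ => 4 * (1 / (p : ℝ) ^ (3 / 2 : ℝ)) :=
    (Real.summable_one_div_nat_rpow.mpr (by norm_num)).mul_left 4
  refine hs.of_nonneg_of_le ?_ ?_
  · intro p
    rcases Nat.lt_or_ge p 2 with h | h
    · interval_cases p <;> simp
    · have : (2 : ℝ) ≤ p := by exact_mod_cast h
      exact div_nonneg (Real.log_natCast_nonneg p) (by nlinarith)
  · intro p
    rcases Nat.lt_or_ge p 2 with h | h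
    · interval_cases p <;> simp
    · have h2 : (2 : ℝ) ≤ p := by exact_mod_cast h
      have h0 : (0 : ℝ) < p := by linarith
      -- `log p ≤ 2 √p`, while `p ^ 2 ≤ 2 p (p - 1)` for `p ≥ 2`; together they give the factor `4`.
      have hl := Real.log_le_rpow_div (x := p) (ε := 1 / 2) h0.le (by norm_num)
      have h3 : (p : ℝ) ^ (1 / 2 : ℝ) * (p : ℝ) ^ (3 / 2 : ℝ) = p ^ 2 := by
        rw [← Real.rpow_add h0]; norm_num
      have h4 : 0 < (p : ℝ) ^ (3 / 2 : ℝ) := Real.rpow_pos_of_pos h0 _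
      rw [mul_one_div, div_le_div_iff₀ (by nlinarith) h4]
      calc Real.log p * (p : ℝ) ^ (3 / 2 : ℝ)
          ≤ ((p : ℝ) ^ (1 / 2 : ℝ) / (1 / 2)) * (p : ℝ) ^ (3 / 2 : ℝ) :=
            mul_le_mul_of_nonneg_right hl h4.le
        _ = 2 * p ^ 2 := by rw [← h3]; ring
        _ ≤ 4 * (p * (p - 1)) := by nlinarith

/-- The exponent of `p` in `N!` is at most `N / (p - 1) = N / p + N / (p (p - 1))`, and the second
term contributes `O(N)` after summation against `log p`. Compare with `log N! ≥ N log N - N`. -/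
theorem exists_le_mertensSum :
    ∃ C : ℝ, ∀ N : ℕ, 0 < N → Real.log N - C ≤ mertensSum N := by
  refine ⟨1 + ∑' p : ℕ, Real.log p / (p * (p - 1)), fun N hN => ?_⟩
  have hN' : (0 : ℝ) < N := by exact_mod_cast hN
  have hnn : ∀ p : ℕ, 0 ≤ Real.log p / ((p : ℝ) * (p - 1)) := by
    intro p
    rcases Nat.lt_or_ge p 2 with h | h
    · interval_cases p <;> simp
    · have : (2 : ℝ) ≤ p := by exact_mod_cast h
      exact div_nonneg (Real.log_natCast_nonneg p) (by nlinarith)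
  have h1 : Real.log N.factorial ≤
      N * (mertensSum N + ∑ p ∈ N.primesLE, Real.log p / ((p : ℝ) * (p - 1))) := by
    rw [log_factorial_eq_sum_primesLE, mertensSum, ← Finset.sum_add_distrib, Finset.mul_sum]
    refine Finset.sum_le_sum fun p hp => ?_
    have hp' := Nat.prime_of_mem_primesLE hp
    have h2 : (2 : ℝ) ≤ p := by exact_mod_cast hp'.two_le
    have hlog : 0 ≤ Real.log p := Real.log_natCast_nonneg p
    have h3 : (N.factorial.factorization p : ℝ) ≤ N / (p - 1) := by
      refine (Nat.cast_le.mpr (Nat.factorization_factorial_le_div_pred hp' N)).trans ?_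
      refine Nat.cast_div_le.trans ?_
      rw [Nat.cast_sub hp'.one_le]; simp
    calc _ ≤ (N / ((p : ℝ) - 1)) * Real.log p := mul_le_mul_of_nonneg_right h3 hlog
      _ = _ := by
        have : (p : ℝ) - 1 ≠ 0 := by linarith
        have : (p : ℝ) ≠ 0 := by linarith
        field_simp
        ring
  have h2 : ∑ p ∈ N.primesLE, Real.log p / ((p : ℝ) * (p - 1)) ≤
      ∑' p : ℕ, Real.log p / ((p : ℝ) * (p - 1)) :=
    summable_log_div_mul_sub_one.sum_le_tsum _ (fun p _ => hnn p)
  have h3 : N * Real.log N - N ≤ Real.log N.factorial := by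
    have := Real.pow_div_factorial_le_exp (x := (N : ℝ)) hN'.le N
    have hf : (0 : ℝ) < N.factorial := by exact_mod_cast Nat.factorial_pos N
    have h4 := Real.log_le_log (by positivity) this
    rw [Real.log_exp, Real.log_div (by positivity) hf.ne', Real.log_pow] at h4
    linarith
  have : (N : ℝ) * (Real.log N - (1 + ∑' p : ℕ, Real.log p / (p * (p - 1)))) ≤
      N * mertensSum N := by
    nlinarith
  exact le_of_mul_le_mul_left this hN'

/-- The primes `p ≤ n` whose size on the logarithmic scale of `n` lies in `[a, b]`. -/
noncomputable def primeWindow (n : ℕ) (a b : ℝ) : Finset ℕ :=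
  n.primesLE.filter fun p => Real.log p / Real.log n ∈ Set.Icc a b

/-- **Mertens' first theorem**, as a lower bound on windows of the logarithmic scale. -/
theorem exists_sub_le_sum_primeWindow :
    ∃ C : ℝ, ∀ (n : ℕ) (a b : ℝ), 2 ≤ n → 0 ≤ a → b ≤ 1 →
      b - a - C / Real.log n ≤
        ∑ p ∈ primeWindow n a b, Real.log p / (p * Real.log n) := by
  obtain ⟨C, hC⟩ := exists_le_mertensSum
  -- `C` is lost in the lower bound at `n ^ b`, `log 4` in the upper bound at `n ^ a`, and `log 2`
  -- in rounding `n ^ b` down. The maximum with `0` settles the case `b < a`.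
  refine ⟨max (C + Real.log 4 + Real.log 2) 0, fun n a b hn ha hb => ?_⟩
  have hn' : (2 : ℝ) ≤ n := by exact_mod_cast hn
  have hn0 : (0 : ℝ) < n := by linarith
  have hl : 0 < Real.log n := Real.log_pos (by linarith)
  have hnn : ∀ p : ℕ, 0 ≤ Real.log p / (p : ℝ) :=
    fun p => div_nonneg (Real.log_natCast_nonneg p) p.cast_nonneg
  have hnn' : ∀ p : ℕ, 0 ≤ Real.log p / (p * Real.log n) := fun p => by
    rw [← div_div]; exact div_nonneg (hnn p) hl.le
  rcases lt_or_ge b a with hab | hab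
  · have h1 : 0 ≤ max (C + Real.log 4 + Real.log 2) 0 / Real.log n :=
      div_nonneg (le_max_right _ _) hl.le
    have h2 := Finset.sum_nonneg (s := primeWindow n a b) fun p _ => hnn' p
    linarith
  set x := (n : ℝ) ^ a with hx
  set y := (n : ℝ) ^ b with hy
  have hx1 : 1 ≤ x := Real.one_le_rpow (by linarith) ha
  have hxy : x ≤ y := Real.rpow_le_rpow_of_exponent_le (by linarith) hab
  have hyn : y ≤ n := by
    simpa using Real.rpow_le_rpow_of_exponent_le (x := (n : ℝ)) (by linarith) hb
  have hlx : Real.log x = a * Real.log n := Real.log_rpow hn0 a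
  have hly : Real.log y = b * Real.log n := Real.log_rpow hn0 b
  have hfx : 0 < ⌊x⌋₊ := Nat.floor_pos.mpr hx1
  have hfy : 0 < ⌊y⌋₊ := Nat.floor_pos.mpr (hx1.trans hxy)
  have hsub : (⌊y⌋₊.primesLE \ ⌊x⌋₊.primesLE) ⊆ primeWindow n a b := by
    intro p hp
    rw [Finset.mem_sdiff, Nat.mem_primesLE, Nat.mem_primesLE] at hp
    obtain ⟨⟨h1, h2⟩, h3⟩ := hp
    have h4 : ⌊x⌋₊ < p := by by_contra h; exact h3 ⟨not_lt.mp h, h2⟩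
    have h5 : x < p := Nat.lt_of_floor_lt h4
    have h6 : (p : ℝ) ≤ y := (Nat.le_floor_iff (by linarith)).mp h1
    have hp0 : (0 : ℝ) < p := by linarith
    rw [primeWindow, Finset.mem_filter, Nat.mem_primesLE]
    refine ⟨⟨by exact_mod_cast h6.trans hyn, h2⟩, ?_, ?_⟩
    · rw [le_div_iff₀ hl, ← hlx]
      exact Real.log_le_log (by linarith) h5.le
    · rw [div_le_iff₀ hl, ← hly]
      exact Real.log_le_log hp0 h6
  have hmono : ⌊x⌋₊.primesLE ⊆ ⌊y⌋₊.primesLE := by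
    intro p hp
    rw [Nat.mem_primesLE] at hp ⊢
    exact ⟨hp.1.trans (Nat.floor_mono hxy), hp.2⟩
  have h1 : mertensSum ⌊y⌋₊ - mertensSum ⌊x⌋₊ ≤
      Real.log n * ∑ p ∈ primeWindow n a b, Real.log p / (p * Real.log n) := by
    rw [mertensSum, mertensSum, ← Finset.sum_sdiff hmono, add_sub_cancel_right, Finset.mul_sum]
    have : ∀ p : ℕ, Real.log n * (Real.log p / (p * Real.log n)) = Real.log p / p := by
      intro p
      rw [← div_div, mul_div_cancel₀ _ hl.ne']
    simp only [this]
    exact Finset.sum_le_sum_of_subset_of_nonneg hsub fun p _ _ => hnn p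
  have h2 := mertensSum_le hfx
  have h3 := hC _ hfy
  have h4 : Real.log ⌊x⌋₊ ≤ a * Real.log n := by
    rw [← hlx]
    exact Real.log_le_log (by exact_mod_cast hfx) (Nat.floor_le (by linarith))
  have h5 : b * Real.log n - Real.log 2 ≤ Real.log ⌊y⌋₊ := by
    rw [← hly, sub_le_iff_le_add, ← Real.log_mul (by exact_mod_cast hfy.ne') (by norm_num)]
    refine Real.log_le_log (by linarith) ?_
    have h6 := (Nat.lt_floor_add_one y).le
    have h7 : (1 : ℝ) ≤ ⌊y⌋₊ := by exact_mod_cast hfy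
    linarith
  have h6 : (b - a - max (C + Real.log 4 + Real.log 2) 0 / Real.log n) * Real.log n =
      (b - a) * Real.log n - max (C + Real.log 4 + Real.log 2) 0 := by
    field_simp
  have h7 := le_max_left (C + Real.log 4 + Real.log 2) 0
  refine le_of_mul_le_mul_right ?_ hl
  rw [h6]
  nlinarith

/-! ### Prime factors as points of the sorted simplex -/

/-- The nonincreasing nonnegative sequences all of whose partial sums are at most `1`. -/
def sortedSimplex : Set (ℕ → ℝ) :=
  {x | Antitone x ∧ (∀ i, 0 ≤ x i) ∧ ∀ n, ∑ i ∈ Finset.range n, x i ≤ 1}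

/-- More than `M` points of size `a ≥ 1 / M` would have sum above `1`. This confines tuples in
windows away from `0` to the first `M` places, making the sums finite and the test functions
continuous. -/
theorem lt_of_le_apply_of_mem_sortedSimplex {x : ℕ → ℝ} (hx : x ∈ sortedSimplex) {a : ℝ} {M j : ℕ}
    (hM : 1 ≤ M * a) (ha : 0 < a) (hj : a ≤ x j) : j < M := by
  have h1 : ((j + 1 : ℕ) : ℝ) * a ≤ 1 := by
    calc ((j + 1 : ℕ) : ℝ) * a = ∑ i ∈ Finset.range (j + 1), a := by simp
      _ ≤ ∑ i ∈ Finset.range (j + 1), x i := Finset.sum_le_sum fun i hi =>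
        hj.trans (hx.1 (Nat.lt_succ_iff.mp (Finset.mem_range.mp hi)))
      _ ≤ 1 := hx.2.2 (j + 1)
  have h2 : ((j + 1 : ℕ) : ℝ) ≤ M := le_of_mul_le_mul_right (h1.trans hM) ha
  exact_mod_cast h2

/-- The default value `1` has logarithm `0`, so running past the end of the list adds nothing. -/
theorem sum_range_log_getD_le (l : List ℕ) (hl : ∀ p ∈ l, 1 ≤ p) (N : ℕ) :
    ∑ i ∈ Finset.range N, Real.log (l.getD i 1 : ℕ) ≤ Real.log (l.prod : ℕ) := by
  induction l generalizing N with
  | nil => simp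
  | cons p l ih =>
    have hp : 1 ≤ p := hl p (by simp)
    have hl' : ∀ q ∈ l, 1 ≤ q := fun q hq => hl q (by simp [hq])
    have h1 : 0 < l.prod := List.prod_pos fun q hq => hl' q hq
    have hlog : Real.log ((p :: l).prod : ℕ) = Real.log p + Real.log (l.prod : ℕ) := by
      rw [List.prod_cons, Nat.cast_mul, Real.log_mul (by positivity) (by positivity)]
    rw [hlog]
    cases N with
    | zero =>
      simpa using add_nonneg (Real.log_natCast_nonneg p) (Real.log_natCast_nonneg l.prod)
    | succ N =>
      rw [Finset.sum_range_succ']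
      have := ih hl' N
      simp only [List.getD_cons_succ, List.getD_cons_zero]
      linarith

theorem one_le_largestPrimeFactor (i m : ℕ) : 1 ≤ largestPrimeFactor i m := by
  rw [largestPrimeFactor, List.getD_eq_getElem?_getD]
  cases h : m.primeFactorsList.reverse[i]? with
  | none => simp
  | some p =>
    have := List.mem_of_getElem? h
    simp only [Option.getD_some]
    exact (Nat.prime_of_mem_primeFactorsList (List.mem_reverse.mp this)).one_le

theorem antitone_largestPrimeFactor (m : ℕ) : Antitone fun i => largestPrimeFactor i m := by
  intro i j hij
  simp only
  by_cases hj : j < m.primeFactorsList.reverse.length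
  · have hs : m.primeFactorsList.reverse.Pairwise (· ≥ ·) := by
      rw [List.pairwise_reverse]
      exact (Nat.primeFactorsList_sorted m).pairwise
    rw [largestPrimeFactor, largestPrimeFactor, List.getD_eq_getElem _ _ hj,
      List.getD_eq_getElem _ _ (hij.trans_lt hj)]
    rcases hij.eq_or_lt with h | h
    · subst h; exact le_rfl
    · exact List.pairwise_iff_getElem.mp hs i j _ hj h
  · rw [largestPrimeFactor, List.getD_eq_default _ _ (not_lt.mp hj)]
    exact one_le_largestPrimeFactor i m

theorem logPrimeFactors_mem_sortedSimplex (n : ℕ+) {m : ℕ} (hm : m ∈ Set.Icc 1 (n : ℕ)) :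
    logPrimeFactors n m ∈ sortedSimplex := by
  have hl : 0 ≤ Real.log (n : ℕ) := Real.log_natCast_nonneg _
  refine ⟨fun i j hij => ?_, fun i => div_nonneg (Real.log_natCast_nonneg _) hl, fun N => ?_⟩
  · refine div_le_div_of_nonneg_right (Real.log_le_log ?_ ?_) hl
    · exact_mod_cast one_le_largestPrimeFactor j m
    · exact_mod_cast antitone_largestPrimeFactor m hij
  · simp only [logPrimeFactors]
    rw [← Finset.sum_div]
    refine div_le_one_of_le₀ ?_ hl
    have h1 := sum_range_log_getD_le m.primeFactorsList.reverse
      (fun p hp => (Nat.prime_of_mem_primeFactorsList (List.mem_reverse.mp hp)).one_le) N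
    rw [List.prod_reverse, Nat.prod_primeFactorsList (by have := hm.1; omega)] at h1
    exact h1.trans (Real.log_le_log (by exact_mod_cast hm.1) (by exact_mod_cast hm.2))

theorem exists_largestPrimeFactor_eq {p m : ℕ} (hp : p.Prime) (hm : m ≠ 0) (h : p ∣ m) :
    ∃ j, largestPrimeFactor j m = p := by
  have : p ∈ m.primeFactorsList.reverse :=
    List.mem_reverse.mpr ((Nat.mem_primeFactorsList hm).mpr ⟨hp, h⟩)
  obtain ⟨j, hj, h⟩ := List.getElem_of_mem this
  exact ⟨j, by rw [largestPrimeFactor, List.getD_eq_getElem _ _ hj, h]⟩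

/-! ### Averages over tuples of prime factors -/

theorem lintegral_uniformUpTo (n : ℕ+) (f : ℕ → ENNReal) :
    ∫⁻ m, f m ∂(uniformUpTo n) = ((n : ℕ) : ENNReal)⁻¹ * ∑ m ∈ Finset.Icc 1 (n : ℕ), f m := by
  have h : (Set.Icc 1 (n : ℕ)) = ((Finset.Icc 1 (n : ℕ) : Finset ℕ) : Set ℕ) := by simp
  have hc : Measure.count (Set.Icc 1 (n : ℕ)) = (n : ℕ) := by
    rw [h, Measure.count_apply_finset]; simp
  rw [uniformUpTo, uniformOn, ProbabilityTheory.cond, lintegral_smul_measure, h,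
    lintegral_finset, ← h, hc]
  simp

/-- The count is `⌊n / P⌋ ≥ n / P - 1`, and the `1` is at most `c n / P`. -/
theorem natCast_mul_one_sub_le_card {n P : ℕ} {c : ℝ} (hP : 0 < P) (hc : (P : ℝ) ≤ c * n) :
    (n : ℝ) * (1 - c) / P ≤ ((Finset.Icc 1 n).filter (P ∣ ·)).card := by
  have h1 : ((Finset.Icc 1 n).filter (P ∣ ·)).card = n / P := Nat.Ioc_filter_dvd_card_eq_div n P
  have hP' : (0 : ℝ) < P := by exact_mod_cast hP
  rw [h1, ← Nat.floor_div_eq_div (K := ℝ)]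
  refine le_trans ?_ (Nat.sub_one_lt_floor _).le
  rw [div_le_iff₀ hP', sub_mul, div_mul_cancel₀ _ hP'.ne']
  nlinarith

/-- Lower bound for a sum over tuples of distinct prime factors of `m`. -/
theorem sum_filter_prod_dvd_le {k M m : ℕ} {n : ℕ+} (hm : m ∈ Set.Icc 1 (n : ℕ))
    {a b : Fin k → ℝ} (ha : ∀ i, 0 < a i) (hM : ∀ i, 1 ≤ M * a i)
    (hab : Pairwise fun i j => Disjoint (Set.Icc (a i) (b i)) (Set.Icc (a j) (b j)))
    {h : (Fin k → ℝ) → ℝ} (hn : ∀ t, 0 ≤ h t)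
    (hh : ∀ t, (∀ i, t i ∈ Set.Icc (a i) (b i)) → ∏ i, t i ≤ h t) :
    ∑ q ∈ (Fintype.piFinset fun i => primeWindow n (a i) (b i)) with (∏ i, q i) ∣ m,
        ∏ i, Real.log (q i) / Real.log (n : ℕ) ≤
      ∑ e : Fin k ↪ Fin M, h fun i => logPrimeFactors n m (e i) := by
  set A := (Fintype.piFinset fun i => primeWindow n (a i) (b i)).filter
    (fun q : Fin k → ℕ => (∏ i, q i) ∣ m) with hA
  have hS := logPrimeFactors_mem_sortedSimplex n hm
  -- Disjoint windows force distinct primes, hence distinct places. The places determine the primes,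
  -- so different tuples `q` use different embeddings.
  have key : ∀ q ∈ A, ∃ e : Fin k ↪ Fin M, ∀ i, largestPrimeFactor (e i) m = q i := by
    intro q hq
    rw [hA, Finset.mem_filter, Fintype.mem_piFinset] at hq
    obtain ⟨hq1, hq2⟩ := hq
    have hw : ∀ i, (q i).Prime ∧ Real.log (q i) / Real.log (n : ℕ) ∈ Set.Icc (a i) (b i) := by
      intro i
      have := hq1 i
      rw [primeWindow, Finset.mem_filter, Nat.mem_primesLE] at this
      exact ⟨this.1.2, this.2⟩
    have hj : ∀ i, ∃ j, largestPrimeFactor j m = q i := fun i =>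
      exists_largestPrimeFactor_eq (hw i).1 (by have := hm.1; omega)
        ((Finset.dvd_prod_of_mem q (Finset.mem_univ i)).trans hq2)
    choose j hj using hj
    have hjM : ∀ i, j i < M := fun i => by
      refine lt_of_le_apply_of_mem_sortedSimplex hS (hM i) (ha i) ?_
      rw [logPrimeFactors, hj i]
      exact (hw i).2.1
    refine ⟨⟨fun i => ⟨j i, hjM i⟩, fun i i' hii => ?_⟩, hj⟩
    by_contra hne
    have h1 : j i = j i' := by simpa using hii
    have h2 : q i = q i' := by rw [← hj i, ← hj i', h1]
    have h3 := (hw i).2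
    rw [h2] at h3
    exact Set.disjoint_left.mp (hab hne) h3 (hw i').2
  rcases A.eq_empty_or_nonempty with hA0 | ⟨q₀, hq₀⟩
  · rw [hA0, Finset.sum_empty]
    exact Finset.sum_nonneg fun _ _ => hn _
  have : Nonempty (Fin k ↪ Fin M) := ⟨(key q₀ hq₀).choose⟩
  choose! e he using key
  have hinj : Set.InjOn e A := by
    intro q hq q' hq' hqq
    funext i
    rw [← he q hq i, ← he q' hq' i, hqq]
  calc ∑ q ∈ A, ∏ i, Real.log (q i) / Real.log (n : ℕ)
      ≤ ∑ q ∈ A, h fun i => logPrimeFactors n m (e q i) := by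
        refine Finset.sum_le_sum fun q hq => ?_
        have h1 : (fun i => logPrimeFactors n m (e q i)) =
            fun i => Real.log (q i) / Real.log (n : ℕ) := by
          funext i; rw [logPrimeFactors, he q hq i]
        rw [h1]
        refine hh _ fun i => ?_
        rw [hA, Finset.mem_filter, Fintype.mem_piFinset] at hq
        exact (Finset.mem_filter.mp (hq.1 i)).2
    _ = ∑ e' ∈ A.image e, h fun i => logPrimeFactors n m (e' i) :=
        (Finset.sum_image (f := fun e' : Fin k ↪ Fin M => h fun i => logPrimeFactors n m (e' i))
          hinj).symm
    _ ≤ _ := Finset.sum_le_sum_of_subset_of_nonneg (Finset.subset_univ _) fun _ _ _ => hn _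

/-- Exchange the sums over integers and over prime tuples. A tuple in the windows has product at
most `n ^ ∑ b i`, so the relative rounding error in its count of multiples is at most `n ^ (∑ b i -
1)`. -/
theorem prod_sum_primeWindow_le {k M : ℕ} {n : ℕ+} (h2 : 2 ≤ (n : ℕ))
    {a b : Fin k → ℝ} (ha : ∀ i, 0 < a i) (hM : ∀ i, 1 ≤ M * a i)
    (hab : Pairwise fun i j => Disjoint (Set.Icc (a i) (b i)) (Set.Icc (a j) (b j)))
    {h : (Fin k → ℝ) → ℝ} (hn : ∀ t, 0 ≤ h t)
    (hh : ∀ t, (∀ i, t i ∈ Set.Icc (a i) (b i)) → ∏ i, t i ≤ h t) :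
    (1 - ((n : ℕ) : ℝ) ^ (∑ i, b i - 1)) *
        ∏ i, ∑ p ∈ primeWindow n (a i) (b i), Real.log p / (p * Real.log (n : ℕ)) ≤
      (((n : ℕ) : ℝ))⁻¹ * ∑ m ∈ Finset.Icc 1 (n : ℕ),
        ∑ e : Fin k ↪ Fin M, h fun i => logPrimeFactors n m (e i) := by
  have hn2 : (2 : ℝ) ≤ (n : ℕ) := by exact_mod_cast h2
  have hn0 : (0 : ℝ) < (n : ℕ) := by linarith
  have hl : 0 < Real.log (n : ℕ) := Real.log_pos (by linarith)
  set W := Fintype.piFinset fun i => primeWindow n (a i) (b i) with hW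
  have h1 : ∑ m ∈ Finset.Icc 1 (n : ℕ), ∑ q ∈ W with (∏ i, q i) ∣ m,
      ∏ i, Real.log (q i) / Real.log (n : ℕ) ≤ ∑ m ∈ Finset.Icc 1 (n : ℕ),
        ∑ e : Fin k ↪ Fin M, h fun i => logPrimeFactors n m (e i) :=
    Finset.sum_le_sum fun m hm =>
      sum_filter_prod_dvd_le (by simpa using hm) ha hM hab hn hh
  refine le_trans ?_ (mul_le_mul_of_nonneg_left h1 (inv_nonneg.mpr hn0.le))
  simp_rw [Finset.sum_filter]
  rw [Finset.sum_comm, Finset.prod_univ_sum, ← hW, Finset.mul_sum, Finset.mul_sum]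
  refine Finset.sum_le_sum fun q hq => ?_
  rw [← Finset.sum_filter, Finset.sum_const, nsmul_eq_mul]
  have hw : ∀ i, (q i).Prime ∧ Real.log (q i) / Real.log (n : ℕ) ∈ Set.Icc (a i) (b i) := by
    intro i
    have := Fintype.mem_piFinset.mp hq i
    rw [primeWindow, Finset.mem_filter, Nat.mem_primesLE] at this
    exact ⟨this.1.2, this.2⟩
  have hP : 0 < ∏ i, q i := Finset.prod_pos fun i _ => (hw i).1.pos
  have hP' : (0 : ℝ) < ∏ i, (q i : ℝ) := by exact_mod_cast hP
  have hc : ((∏ i, q i : ℕ) : ℝ) ≤ ((n : ℕ) : ℝ) ^ (∑ i, b i - 1) * (n : ℕ) := by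
    rw [← Real.rpow_add_one hn0.ne', sub_add_cancel, Real.rpow_sum_of_pos hn0, Nat.cast_prod]
    refine Finset.prod_le_prod (fun i _ => Nat.cast_nonneg _) fun i _ => ?_
    rw [← Real.log_le_log_iff (by exact_mod_cast (hw i).1.pos) (Real.rpow_pos_of_pos hn0 _),
      Real.log_rpow hn0, ← div_le_iff₀ hl]
    exact (hw i).2.2
  have h3 := natCast_mul_one_sub_le_card hP hc
  have hpos : 0 ≤ ∏ i, Real.log (q i) / Real.log (n : ℕ) :=
    Finset.prod_nonneg fun i _ => div_nonneg (Real.log_natCast_nonneg _) hl.le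
  have h4 : ∏ i, Real.log (q i) / (q i * Real.log (n : ℕ)) =
      (∏ i, Real.log (q i) / Real.log (n : ℕ)) / ((∏ i, q i : ℕ) : ℝ) := by
    rw [Nat.cast_prod, ← Finset.prod_div_distrib]
    refine Finset.prod_congr rfl fun i _ => ?_
    rw [div_div, mul_comm]
  rw [h4]
  calc _ = (((n : ℕ) : ℝ))⁻¹ * ((((n : ℕ) : ℝ) * (1 - ((n : ℕ) : ℝ) ^ (∑ i, b i - 1)) /
          ((∏ i, q i : ℕ) : ℝ)) * ∏ i, Real.log (q i) / Real.log (n : ℕ)) := by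
        field_simp
    _ ≤ _ := by gcongr

/-! ### Lebesgue measure on simplices -/

open scoped ENNReal

/-- The open simplex of tuples of positive numbers with sum less than `1`. -/
def tupleSimplex (k : ℕ) : Set (Fin k → ℝ) := {t | (∀ i, 0 < t i) ∧ ∑ i, t i < 1}

theorem isOpen_tupleSimplex (k : ℕ) : IsOpen (tupleSimplex k) := by
  have h : tupleSimplex k = (⋂ i, {t | 0 < t i}) ∩ {t | ∑ i, t i < 1} := by
    ext t; simp [tupleSimplex]
  rw [h]
  exact (isOpen_iInter_of_finite fun i => isOpen_lt continuous_const (by fun_prop)).inter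
    (isOpen_lt (by fun_prop) continuous_const)

theorem measurableSet_tupleSimplex (k : ℕ) : MeasurableSet (tupleSimplex k) :=
  (isOpen_tupleSimplex k).measurableSet

theorem cons_mem_tupleSimplex {k : ℕ} {s : ℝ} {t : Fin k → ℝ} :
    (Fin.cons s t : Fin (k + 1) → ℝ) ∈ tupleSimplex (k + 1) ↔
      t ∈ tupleSimplex k ∧ s ∈ Set.Ioo 0 (1 - ∑ i, t i) := by
  simp only [tupleSimplex, Set.mem_ofPred_eq, Fin.forall_fin_succ, Fin.cons_zero, Fin.cons_succ,
    Fin.sum_univ_succ, Set.mem_Ioo]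
  constructor
  · rintro ⟨⟨h1, h2⟩, h3⟩
    exact ⟨⟨h2, by linarith⟩, h1, by linarith⟩
  · rintro ⟨⟨h1, h2⟩, h3, h4⟩
    exact ⟨⟨h3, h1⟩, by linarith⟩

theorem lintegral_fin_cons {k : ℕ} {f : (Fin (k + 1) → ℝ) → ℝ≥0∞} (hf : Measurable f) :
    ∫⁻ t, f t = ∫⁻ t : Fin k → ℝ, ∫⁻ s : ℝ, f (Fin.cons s t) := by
  have h := (volume_preserving_piFinSuccAbove (fun _ : Fin (k + 1) => ℝ) 0).symm
  rw [← h.lintegral_comp hf, Measure.volume_eq_prod, lintegral_prod_symm' _ (by fun_prop)]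
  simp [MeasurableEquiv.piFinSuccAbove, Fin.consEquiv]

theorem setLIntegral_tupleSimplex_succ {k : ℕ} {f : (Fin (k + 1) → ℝ) → ℝ≥0∞}
    (hf : Measurable f) :
    ∫⁻ t in tupleSimplex (k + 1), f t =
      ∫⁻ t in tupleSimplex k, ∫⁻ s in Set.Ioo 0 (1 - ∑ i, t i), f (Fin.cons s t) := by
  rw [← lintegral_indicator (measurableSet_tupleSimplex _),
    ← lintegral_indicator (measurableSet_tupleSimplex _),
    lintegral_fin_cons (hf.indicator (measurableSet_tupleSimplex _))]
  refine lintegral_congr fun t => ?_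
  by_cases ht : t ∈ tupleSimplex k
  · rw [Set.indicator_of_mem ht, ← lintegral_indicator measurableSet_Ioo]
    refine lintegral_congr fun s => ?_
    by_cases hs : s ∈ Set.Ioo 0 (1 - ∑ i, t i)
    · rw [Set.indicator_of_mem hs, Set.indicator_of_mem (cons_mem_tupleSimplex.mpr ⟨ht, hs⟩)]
    · rw [Set.indicator_of_notMem hs,
        Set.indicator_of_notMem fun h => hs (cons_mem_tupleSimplex.mp h).2]
  · rw [Set.indicator_of_notMem ht, lintegral_eq_zero_of_ae_eq_zero]
    refine Eventually.of_forall fun s => ?_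
    exact Set.indicator_of_notMem (fun h => ht (cons_mem_tupleSimplex.mp h).1) _

theorem volume_tupleSimplex_succ (k : ℕ) :
    volume (tupleSimplex (k + 1)) =
      ∫⁻ t in tupleSimplex k, ENNReal.ofReal (1 - ∑ i, t i) := by
  rw [← setLIntegral_one, setLIntegral_tupleSimplex_succ measurable_const]
  simp

/-! ### Size-biased tuples and the mass bound -/

/-- The law of `k` points of the random sequence with law `μ`, picked at distinct places with
probabilities given by the points themselves. -/
noncomputable def sizeBiased (μ : Measure (ℕ → ℝ)) (k : ℕ) : Measure (Fin k → ℝ) :=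
  Measure.sum fun e : Fin k ↪ ℕ =>
    (μ.withDensity fun x => ∏ i, ENNReal.ofReal (x (e i))).map fun x i => x (e i)

instance countable_fin_embedding (k : ℕ) : Countable (Fin k ↪ ℕ) :=
  DFunLike.coe_injective.countable

theorem lintegral_sizeBiased (μ : Measure (ℕ → ℝ)) {k : ℕ} {G : (Fin k → ℝ) → ℝ≥0∞}
    (hG : Measurable G) :
    ∫⁻ t, G t ∂(sizeBiased μ k) =
      ∫⁻ x, ∑' e : Fin k ↪ ℕ, (∏ i, ENNReal.ofReal (x (e i))) * G (fun i => x (e i)) ∂μ := by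
  rw [sizeBiased, lintegral_sum_measure, lintegral_tsum fun e => by fun_prop]
  refine tsum_congr fun e => ?_
  rw [lintegral_map hG (by fun_prop), lintegral_withDensity_eq_lintegral_mul _ (by fun_prop)
    (by fun_prop)]
  rfl

theorem tsum_embedding_succ {k : ℕ} (F : (Fin (k + 1) → ℕ) → ℝ≥0∞) :
    ∑' e : Fin (k + 1) ↪ ℕ, F e =
      ∑' (e : Fin k ↪ ℕ) (j : {j // j ∉ Set.range e}), F (Fin.cons (j : ℕ) e) := by
  rw [← (Equiv.embeddingFinSucc k ℕ).symm.tsum_eq, ENNReal.tsum_sigma']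
  simp

theorem cons_comp_eq {k : ℕ} (x : ℕ → ℝ) (j : ℕ) (e : Fin k → ℕ) :
    (fun i => x ((Fin.cons j e : Fin (k + 1) → ℕ) i)) =
      (Fin.cons (x j) fun i => x (e i) : Fin (k + 1) → ℝ) := by
  funext i
  refine Fin.cases ?_ (fun i => ?_) i <;> simp

theorem tsum_ofReal_le_one {x : ℕ → ℝ} (hx : x ∈ sortedSimplex) :
    ∑' j, ENNReal.ofReal (x j) ≤ 1 := by
  rw [ENNReal.tsum_eq_iSup_nat]
  refine iSup_le fun n => ?_
  rw [← ENNReal.ofReal_sum_of_nonneg fun i _ => hx.2.1 i]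
  simpa using ENNReal.ofReal_le_ofReal (hx.2.2 n)

theorem sum_add_tsum_notMem_range {k : ℕ} (f : ℕ → ℝ≥0∞) (e : Fin k ↪ ℕ) :
    ∑ i, f (e i) + ∑' j : {j // j ∉ Set.range e}, f j = ∑' j, f j := by
  rw [← ENNReal.summable.tsum_add_tsum_compl (s := Set.range e) ENNReal.summable,
    tsum_range f e.injective, tsum_fintype (L := .unconditional (Fin k))]
  rfl

theorem tsum_notMem_range_le {k : ℕ} {x : ℕ → ℝ} (hx : x ∈ sortedSimplex) (e : Fin k ↪ ℕ) :
    ∑' j : {j // j ∉ Set.range e}, ENNReal.ofReal (x j) ≤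
      ENNReal.ofReal (1 - ∑ i, x (e i)) := by
  have h1 := sum_add_tsum_notMem_range (fun j => ENNReal.ofReal (x j)) e
  have h2 := tsum_ofReal_le_one hx
  rw [← h1, ← ENNReal.ofReal_sum_of_nonneg fun i _ => hx.2.1 _] at h2
  rw [ENNReal.ofReal_sub _ (Finset.sum_nonneg fun i _ => hx.2.1 _), ENNReal.ofReal_one]
  exact ENNReal.le_sub_of_add_le_left ENNReal.ofReal_ne_top h2

/-- Summing out the new place leaves the total of the points not yet picked, which is at most `1`
minus the sum of those picked. -/
theorem sizeBiased_succ_univ_le {μ : Measure (ℕ → ℝ)} (hμ : ∀ᵐ x ∂μ, x ∈ sortedSimplex) (k : ℕ) :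
    sizeBiased μ (k + 1) Set.univ ≤
      ∫⁻ t, ENNReal.ofReal (1 - ∑ i, t i) ∂(sizeBiased μ k) := by
  rw [← lintegral_one, lintegral_sizeBiased _ measurable_const,
    lintegral_sizeBiased _ (by fun_prop)]
  refine lintegral_mono_ae (hμ.mono fun x hx => ?_)
  rw [tsum_embedding_succ fun e => (∏ i, ENNReal.ofReal (x (e i))) * 1]
  refine ENNReal.tsum_le_tsum fun e => ?_
  simp only [Fin.prod_univ_succ, Fin.cons_zero, Fin.cons_succ, mul_one]
  rw [ENNReal.tsum_mul_right, mul_comm]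
  gcongr
  exact tsum_notMem_range_le hx e

theorem sizeBiased_zero (μ : Measure (ℕ → ℝ)) [IsProbabilityMeasure μ] :
    sizeBiased μ 0 = volume.restrict (tupleSimplex 0) := by
  have h1 : tupleSimplex 0 = Set.univ := by ext t; simp [tupleSimplex]
  rw [h1, Measure.restrict_univ]
  refine Measure.ext_of_lintegral _ fun G hG => ?_
  rw [lintegral_sizeBiased _ hG, volume_pi, Measure.pi_of_empty _ 0, lintegral_dirac]
  have h2 : ∀ x : ℕ → ℝ, ∀ e : Fin 0 ↪ ℕ, (fun i => x (e i)) = (0 : Fin 0 → ℝ) :=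
    fun x e => Subsingleton.elim _ _
  simp [h2, tsum_fintype]

theorem sizeBiased_univ_le_one {μ : Measure (ℕ → ℝ)} [IsProbabilityMeasure μ]
    (hμ : ∀ᵐ x ∂μ, x ∈ sortedSimplex) (k : ℕ) : sizeBiased μ k Set.univ ≤ 1 := by
  induction k with
  | zero =>
    rw [← lintegral_one, lintegral_sizeBiased _ measurable_const]
    simp [tsum_fintype]
  | succ k ih =>
    refine (sizeBiased_succ_univ_le hμ k).trans (le_trans ?_ ih)
    rw [← lintegral_one, lintegral_sizeBiased _ (by fun_prop),
      lintegral_sizeBiased _ measurable_const]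
    refine lintegral_mono_ae (hμ.mono fun x hx => ENNReal.tsum_le_tsum fun e => ?_)
    gcongr
    rw [← ENNReal.ofReal_one]
    refine ENNReal.ofReal_le_ofReal ?_
    linarith [Finset.sum_nonneg fun i (_ : i ∈ Finset.univ) => hx.2.1 (e i)]

theorem isFiniteMeasure_sizeBiased {μ : Measure (ℕ → ℝ)} [IsProbabilityMeasure μ]
    (hμ : ∀ᵐ x ∂μ, x ∈ sortedSimplex) (k : ℕ) : IsFiniteMeasure (sizeBiased μ k) :=
  ⟨(sizeBiased_univ_le_one hμ k).trans_lt ENNReal.one_lt_top⟩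

/-- If the size-biased laws dominate Lebesgue measure on the simplices, then they are equal to
it: there is no room for excess mass. -/
theorem sizeBiased_eq_restrict {μ : Measure (ℕ → ℝ)} [IsProbabilityMeasure μ]
    (hμ : ∀ᵐ x ∂μ, x ∈ sortedSimplex)
    (hle : ∀ k, volume.restrict (tupleSimplex k) ≤ sizeBiased μ k) (k : ℕ) :
    sizeBiased μ k = volume.restrict (tupleSimplex k) := by
  induction k with
  | zero => exact sizeBiased_zero μ
  | succ k ih =>
    have := isFiniteMeasure_sizeBiased hμ (k + 1)
    have := isFiniteMeasure_of_le _ (hle (k + 1))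
    refine (Measure.eq_of_le_of_measure_univ_eq (hle (k + 1))
      (le_antisymm (hle (k + 1) _) ?_)).symm
    refine (sizeBiased_succ_univ_le hμ k).trans ?_
    rw [ih, Measure.restrict_apply_univ, volume_tupleSimplex_succ]

/-! ### Limit laws dominate Lebesgue measure -/

/-- The law of the sequence of the logarithmic sizes of the prime factors of a random integer. -/
noncomputable def primeFactorLaw (n : ℕ+) : ProbabilityMeasure (ℕ → ℝ) :=
  ⟨(uniformUpTo n).map (logPrimeFactors n),
    Measure.isProbabilityMeasure_map (Measurable.of_discrete).aemeasurable⟩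

theorem lintegral_primeFactorLaw (n : ℕ+) {f : (ℕ → ℝ) → ℝ≥0∞} (hf : Measurable f) :
    ∫⁻ x, f x ∂(primeFactorLaw n : Measure (ℕ → ℝ)) =
      ((n : ℕ) : ℝ≥0∞)⁻¹ * ∑ m ∈ Finset.Icc 1 (n : ℕ), f (logPrimeFactors n m) := by
  rw [primeFactorLaw, ProbabilityMeasure.coe_mk, lintegral_map hf Measurable.of_discrete,
    lintegral_uniformUpTo]

open scoped BoundedContinuousFunction in
-- Carries the Mertens bound to the limit. Weak convergence needs a bounded continuous test
-- function, so `h` interpolates: at least `∏ t i` on the box, at most `∏ t i` times the indicator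
-- of `B` everywhere.
theorem prod_le_sizeBiased_of_tendsto {l : Filter ℕ+} [l.NeBot] (hl : l ≤ atTop)
    {ν : ProbabilityMeasure (ℕ → ℝ)} (hν : Tendsto primeFactorLaw l (𝓝 ν)) {k : ℕ}
    {a b : Fin k → ℝ} (ha : ∀ i, 0 < a i) (hb : ∀ i, b i ≤ 1) (hsum : ∑ i, b i < 1)
    (hab : Pairwise fun i j => Disjoint (Set.Icc (a i) (b i)) (Set.Icc (a j) (b j)))
    (h : (Fin k → ℝ) →ᵇ NNReal)
    (hh : ∀ t, (∀ i, t i ∈ Set.Icc (a i) (b i)) → ∏ i, t i ≤ h t)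
    {B : Set (Fin k → ℝ)} (hB : MeasurableSet B)
    (hhB : ∀ t, (h t : ℝ≥0∞) ≤ (∏ i, ENNReal.ofReal (t i)) * B.indicator 1 t) :
    ∏ i, ENNReal.ofReal (b i - a i) ≤ sizeBiased (ν : Measure (ℕ → ℝ)) k B := by
  obtain ⟨M, hM⟩ : ∃ M : ℕ, ∀ i, 1 ≤ M * a i := by
    have : ∀ᶠ M : ℕ in atTop, ∀ i, 1 ≤ M * a i := by
      rw [eventually_all]
      intro i
      exact (tendsto_natCast_atTop_atTop.atTop_mul_const (ha i)).eventually_ge_atTop 1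
    exact this.exists
  obtain ⟨C, hC⟩ := exists_sub_le_sum_primeWindow
  have hcont : ∀ e : Fin k ↪ Fin M, Continuous fun (x : ℕ → ℝ) (i : Fin k) => x (e i) :=
    fun e => by fun_prop
  have hmeas : ∀ e : Fin k ↪ Fin M, Measurable fun x : ℕ → ℝ => (h fun i => x (e i) : ℝ≥0∞) :=
    fun e => measurable_coe_nnreal_ennreal.comp (h.continuous.comp (hcont e)).measurable
  have hlim : Tendsto (fun n => ∑ e : Fin k ↪ Fin M,
      ∫⁻ x, (h fun i => x (e i)) ∂(primeFactorLaw n : Measure (ℕ → ℝ))) l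
      (𝓝 (∑ e : Fin k ↪ Fin M, ∫⁻ x, (h fun i => x (e i)) ∂(ν : Measure (ℕ → ℝ)))) :=
    tendsto_finsetSum _ fun e _ =>
      (ProbabilityMeasure.tendsto_iff_forall_lintegral_tendsto.mp hν)
        (h.compContinuous ⟨_, hcont e⟩)
  have hcast : Tendsto (fun n : ℕ+ => ((n : ℕ) : ℝ)) l atTop :=
    (tendsto_natCast_atTop_atTop.comp tendsto_PNat_val_atTop_atTop).mono_left hl
  have hlog : Tendsto (fun n : ℕ+ => C / Real.log (n : ℕ)) l (𝓝 0) :=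
    (Real.tendsto_log_atTop.comp hcast).const_div_atTop C
  have hpow : Tendsto (fun n : ℕ+ => ((n : ℕ) : ℝ) ^ (∑ i, b i - 1)) l (𝓝 0) := by
    have := (tendsto_rpow_neg_atTop (y := 1 - ∑ i, b i) (by linarith)).comp hcast
    simpa [Function.comp_def] using this
  have hlow : Tendsto (fun n : ℕ+ => ENNReal.ofReal (1 - ((n : ℕ) : ℝ) ^ (∑ i, b i - 1)) *
      ∏ i, ENNReal.ofReal (b i - a i - C / Real.log (n : ℕ))) l
      (𝓝 (ENNReal.ofReal (1 - 0) * ∏ i, ENNReal.ofReal (b i - a i - 0))) := by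
    refine ENNReal.Tendsto.mul (ENNReal.tendsto_ofReal (tendsto_const_nhds.sub hpow))
      (Or.inl (by simp)) ?_ (Or.inr (by simp))
    refine ENNReal.tendsto_finsetProd_of_ne_top _ (fun i _ => ?_) fun i _ => by simp
    exact ENNReal.tendsto_ofReal (tendsto_const_nhds.sub hlog)
  have hev : ∀ᶠ n : ℕ+ in l, ENNReal.ofReal (1 - ((n : ℕ) : ℝ) ^ (∑ i, b i - 1)) *
      ∏ i, ENNReal.ofReal (b i - a i - C / Real.log (n : ℕ)) ≤ ∑ e : Fin k ↪ Fin M,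
      ∫⁻ x, (h fun i => x (e i)) ∂(primeFactorLaw n : Measure (ℕ → ℝ)) := by
    filter_upwards [hl (eventually_ge_atTop (2 : ℕ+)), hcast.eventually_gt_atTop 0] with n hn hn0
    have hn2 : 2 ≤ (n : ℕ) := by exact_mod_cast hn
    have hpow1 : ((n : ℕ) : ℝ) ^ (∑ i, b i - 1) ≤ 1 :=
      Real.rpow_le_one_of_one_le_of_nonpos (by exact_mod_cast n.2) (by linarith)
    have hwin : ∀ i, 0 ≤ ∑ p ∈ primeWindow n (a i) (b i), Real.log p / (p * Real.log (n : ℕ)) :=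
      fun i => Finset.sum_nonneg fun p _ => div_nonneg (Real.log_natCast_nonneg _)
        (mul_nonneg (Nat.cast_nonneg _) (Real.log_natCast_nonneg _))
    have hmain := ENNReal.ofReal_le_ofReal (prod_sum_primeWindow_le (M := M) hn2 ha hM hab
      (h := fun t => (h t : ℝ)) (fun t => (h t).2) hh)
    rw [ENNReal.ofReal_mul (by linarith), ENNReal.ofReal_prod_of_nonneg fun i _ => hwin i,
      ENNReal.ofReal_mul (by positivity), ENNReal.ofReal_inv_of_pos hn0,
      ENNReal.ofReal_natCast, ENNReal.ofReal_sum_of_nonneg fun m _ =>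
        Finset.sum_nonneg fun e _ => NNReal.coe_nonneg _] at hmain
    refine le_trans ?_ (hmain.trans_eq ?_)
    · gcongr with i
      exact hC n (a i) (b i) hn2 (ha i).le (hb i)
    · simp_rw [lintegral_primeFactorLaw n (hmeas _)]
      rw [← Finset.mul_sum, Finset.sum_comm]
      congr 1
      refine Finset.sum_congr rfl fun m _ => ?_
      rw [ENNReal.ofReal_sum_of_nonneg fun e _ => NNReal.coe_nonneg _]
      simp
  have h1 := le_of_tendsto_of_tendsto hlow hlim hev
  simp only [sub_zero, ENNReal.ofReal_one, one_mul] at h1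
  refine h1.trans ?_
  rw [← lintegral_indicator_one hB, lintegral_sizeBiased _ (measurable_one.indicator hB),
    ← lintegral_finsetSum _ fun e _ => hmeas e]
  refine lintegral_mono fun x => ?_
  have hinj : Function.Injective fun e : Fin k ↪ Fin M => e.trans Fin.valEmbedding := by
    intro e e' hee
    ext i
    simpa using DFunLike.congr_fun hee i
  refine le_trans ?_ (ENNReal.tsum_comp_le_tsum_of_injective hinj _)
  rw [tsum_fintype (L := .unconditional _)]
  exact Finset.sum_le_sum fun e _ => hhB _

open scoped BoundedContinuousFunction in
theorem volume_closedBall_le_sizeBiased {l : Filter ℕ+} [l.NeBot] (hl : l ≤ atTop)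
    {ν : ProbabilityMeasure (ℕ → ℝ)} (hν : Tendsto primeFactorLaw l (𝓝 ν)) {k : ℕ}
    {t : Fin k → ℝ} {r : ℝ} (hr : 0 < r) (ht : ∀ i, r < t i) (hsum : ∑ i, (t i + r) < 1)
    (hne : ∀ i j, i ≠ j → 2 * r < |t i - t j|) :
    volume (Metric.closedBall t r) ≤
      sizeBiased (ν : Measure (ℕ → ℝ)) k (Metric.closedBall t r) := by
  have hle1 : ∀ i, t i + r ≤ 1 := fun i =>
    (Finset.single_le_sum (f := fun i => t i + r) (fun j _ => by linarith [ht j])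
      (Finset.mem_univ i)).trans hsum.le
  -- The gap between the cubes of radii `r'` and `r` leaves room for a continuous cutoff. Truncating
  -- the coordinates at `1` keeps the test function bounded and changes nothing on the inner cube,
  -- where `t i + r ≤ 1`.
  have key : ∀ r', 0 < r' → r' < r → ENNReal.ofReal ((2 * r') ^ k) ≤
      sizeBiased (ν : Measure (ℕ → ℝ)) k (Metric.closedBall t r) := by
    intro r' hr' hrr
    set g : (Fin k → ℝ) → NNReal := fun s => (∏ i, (min 1 (s i)).toNNReal) *
      thickenedIndicator (sub_pos.mpr hrr) (Metric.closedBall t r') s with hg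
    have hg1 : ∀ s, g s ≤ 1 := fun s => mul_le_one'
      (Finset.prod_le_one' fun i _ => by simp) (thickenedIndicator_le_one _ _ _)
    have hgc : Continuous g := by
      refine Continuous.mul ?_ (thickenedIndicator _ _).continuous
      fun_prop
    let h : (Fin k → ℝ) →ᵇ NNReal := BoundedContinuousFunction.mkOfBound ⟨g, hgc⟩ 1 fun x y => by
      rw [NNReal.dist_eq, abs_le]
      have h1 : ((g x : NNReal) : ℝ) ≤ 1 := by exact_mod_cast hg1 x
      have h2 : ((g y : NNReal) : ℝ) ≤ 1 := by exact_mod_cast hg1 y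
      constructor
      · change -1 ≤ ((g x : NNReal) : ℝ) - g y
        linarith [(g x).coe_nonneg]
      · change ((g x : NNReal) : ℝ) - g y ≤ 1
        linarith [(g y).coe_nonneg]
    have hmain := prod_le_sizeBiased_of_tendsto hl hν (a := fun i => t i - r')
      (b := fun i => t i + r') (fun i => by linarith [ht i]) (fun i => by linarith [hle1 i])
      (lt_of_le_of_lt (Finset.sum_le_sum fun i _ => by linarith) hsum)
      (fun i j hij => ?_) h ?_ (B := Metric.closedBall t r) measurableSet_closedBall ?_
    · refine le_trans (le_of_eq ?_) hmain
      have : ∀ i : Fin k, t i + r' - (t i - r') = 2 * r' := fun i => by ring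
      simp only [this, Finset.prod_const, Finset.card_univ, Fintype.card_fin]
      rw [ENNReal.ofReal_pow (by linarith)]
    · refine Set.disjoint_left.mpr fun y hy hy' => ?_
      have := hne i j hij
      rw [lt_abs] at this
      rcases this with h | h <;> linarith [hy.1, hy.2, hy'.1, hy'.2]
    · intro s hs
      have hs' : s ∈ Metric.closedBall t r' := by
        rw [Metric.mem_closedBall, dist_pi_le_iff hr'.le]
        intro i
        rw [Real.dist_eq, abs_le]
        constructor <;> linarith [(hs i).1, (hs i).2]
      change _ ≤ ((g s : NNReal) : ℝ)
      rw [hg]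
      simp only [thickenedIndicator_one _ _ hs', mul_one, NNReal.coe_prod]
      refine le_of_eq (Finset.prod_congr rfl fun i _ => ?_)
      rw [min_eq_right (by linarith [(hs i).2, hle1 i]), Real.coe_toNNReal]
      linarith [(hs i).1, ht i]
    · intro s
      change ((g s : NNReal) : ℝ≥0∞) ≤ _
      by_cases hs : s ∈ Metric.closedBall t r
      · rw [Set.indicator_of_mem hs, Pi.one_apply, mul_one, hg]
        calc _ ≤ (((∏ i, (min 1 (s i)).toNNReal) * 1 : NNReal) : ℝ≥0∞) := by
              exact ENNReal.coe_le_coe.mpr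
                (mul_le_mul_right (thickenedIndicator_le_one _ _ _) _)
          _ ≤ _ := by
              rw [mul_one, ENNReal.ofNNReal_finsetProd]
              gcongr with i
              exact ENNReal.ofReal_le_ofReal (min_le_right _ _)
      · have : s ∉ Metric.thickening (r - r') (Metric.closedBall t r') := by
          intro hs'
          obtain ⟨z, hz, hzs⟩ := Metric.mem_thickening_iff.mp hs'
          apply hs
          rw [Metric.mem_closedBall] at hz ⊢
          linarith [dist_triangle s z t]
        rw [hg]
        simp only [thickenedIndicator_zero _ _ this, mul_zero]
        simp
  rw [Real.volume_pi_closedBall t hr.le, Fintype.card_fin]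
  have hlim : Tendsto (fun r' : ℝ => ENNReal.ofReal ((2 * r') ^ k)) (𝓝[<] r)
      (𝓝 (ENNReal.ofReal ((2 * r) ^ k))) := by
    have : Continuous fun r' : ℝ => ENNReal.ofReal ((2 * r') ^ k) :=
      ENNReal.continuous_ofReal.comp (by fun_prop)
    exact (this.tendsto r).mono_left nhdsWithin_le_nhds
  refine le_of_tendsto hlim ?_
  filter_upwards [Ioo_mem_nhdsLT hr] with r' hr' using key r' hr'.1 hr'.2

theorem volume_apply_eq_apply {k : ℕ} {i j : Fin k} (hij : i ≠ j) :
    volume {t : Fin k → ℝ | t i = t j} = 0 := by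
  let f : (Fin k → ℝ) →ₗ[ℝ] ℝ := LinearMap.proj (R := ℝ) (φ := fun _ => ℝ) i - LinearMap.proj j
  have h1 : {t : Fin k → ℝ | t i = t j} = (LinearMap.ker f : Set (Fin k → ℝ)) := by
    ext t; simp [f, sub_eq_zero]
  rw [h1]
  refine Measure.addHaar_submodule _ _ fun h => ?_
  have h2 : Pi.single i (1 : ℝ) ∈ LinearMap.ker f := h ▸ Submodule.mem_top
  simp [f, hij.symm] at h2

theorem ae_injective (k : ℕ) : ∀ᵐ t : Fin k → ℝ, Function.Injective t := by
  have : ∀ᵐ t : Fin k → ℝ, ∀ i j, i ≠ j → t i ≠ t j := by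
    simp only [ae_all_iff]
    intro i j hij
    rw [ae_iff]
    simpa using volume_apply_eq_apply hij
  filter_upwards [this] with t ht i j hij
  by_contra hne
  exact ht i j hne hij

/-- At a point of the open simplex with distinct coordinates, all small cubes satisfy the hypotheses
of `volume_closedBall_le_sizeBiased`. Such points have full measure, and Vitali's theorem passes
from cubes to measurable sets. -/
theorem restrict_le_sizeBiased {l : Filter ℕ+} [l.NeBot] (hl : l ≤ atTop)
    {ν : ProbabilityMeasure (ℕ → ℝ)} (hν : Tendsto primeFactorLaw l (𝓝 ν))
    (hS : ∀ᵐ x ∂(ν : Measure (ℕ → ℝ)), x ∈ sortedSimplex) (k : ℕ) :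
    volume.restrict (tupleSimplex k) ≤ sizeBiased (ν : Measure (ℕ → ℝ)) k := by
  have := isFiniteMeasure_sizeBiased hS k
  refine Measure.le_iff.mpr fun s hs => ?_
  rw [Measure.restrict_apply hs]
  set s' := s ∩ tupleSimplex k ∩ {t | Function.Injective t} with hs'
  have h1 : volume (s ∩ tupleSimplex k) ≤ volume s' := by
    refine measure_mono_ae ?_
    filter_upwards [ae_injective k] with t ht h using ⟨h, ht⟩
  refine (h1.trans ?_).trans (measure_mono (fun t ht => ht.1.1 : s' ⊆ s))
  refine (IsUnifLocDoublingMeasure.vitaliFamily (volume : Measure (Fin k → ℝ))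
    1).measure_le_of_frequently_le _ Measure.AbsolutelyContinuous.rfl s' fun t ht => ?_
  obtain ⟨⟨-, ht0, ht1⟩, hti⟩ := ht
  have htend : Tendsto (fun r : ℝ => Metric.closedBall t r) (𝓝[>] 0)
      ((IsUnifLocDoublingMeasure.vitaliFamily (volume : Measure (Fin k → ℝ)) 1).filterAt t) := by
    refine IsUnifLocDoublingMeasure.tendsto_closedBall_filterAt _ (K := 1) (fun _ => t)
      (fun r => r) tendsto_id ?_
    filter_upwards [self_mem_nhdsWithin] with r hr
    have hr' : (0 : ℝ) < r := hr
    simpa using hr'.le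
  refine htend.frequently (Eventually.frequently ?_)
  have e1 : ∀ᶠ r : ℝ in 𝓝[>] 0, ∀ i, r < t i := by
    rw [eventually_all]
    exact fun i => mem_nhdsWithin_of_mem_nhds (Iio_mem_nhds (ht0 i))
  have e2 : ∀ᶠ r : ℝ in 𝓝[>] 0, ∑ i, (t i + r) < 1 := by
    refine mem_nhdsWithin_of_mem_nhds ?_
    have : Continuous fun r : ℝ => ∑ i, (t i + r) := by fun_prop
    refine this.continuousAt.eventually_lt continuousAt_const ?_
    simpa using ht1
  have e3 : ∀ᶠ r : ℝ in 𝓝[>] 0, ∀ i j, i ≠ j → 2 * r < |t i - t j| := by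
    simp only [eventually_all]
    intro i j hij
    refine mem_nhdsWithin_of_mem_nhds ?_
    have : Continuous fun r : ℝ => 2 * r := by fun_prop
    refine this.continuousAt.eventually_lt continuousAt_const ?_
    simpa [sub_eq_zero] using fun h => hij (hti h)
  filter_upwards [e1, e2, e3, self_mem_nhdsWithin] with r h1 h2 h3 h0
  exact volume_closedBall_le_sizeBiased hl hν h0 h1 h2 h3

/-! ### Analysis of the Dickman function -/

theorem continuous_dickman_max : Continuous fun u : ℝ => dickman (max u 0) :=
  continuousOn_dickman.comp_continuous (by fun_prop) fun u => le_max_right u 0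

theorem dickman_max_eq {u : ℝ} (hu : 0 ≤ u) : dickman (max u 0) = dickman u := by
  rw [max_eq_left hu]

theorem hasDerivAt_dickman {u : ℝ} (hu : 1 < u) :
    HasDerivAt dickman (-(dickman (u - 1) / u)) u := by
  set g : ℝ → ℝ := fun t => dickman (max (t - 1) 0) / max t 1 with hg
  have hgc : Continuous g := by
    refine (continuous_dickman_max.comp (by fun_prop : Continuous fun t : ℝ => t - 1)).div
      (by fun_prop) fun t => ?_
    have : (1 : ℝ) ≤ max t 1 := le_max_right _ _
    positivity
  have h1 : ∀ v, 1 ≤ v → dickman v = 1 - ∫ t in (1 : ℝ)..v, g t := by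
    intro v hv
    rw [dickman_of_one_le v hv]
    congr 1
    refine intervalIntegral.integral_congr fun t ht => ?_
    rw [Set.uIcc_of_le hv] at ht
    simp only [hg]
    rw [max_eq_left ht.1, dickman_max_eq (by linarith [ht.1])]
  have h2 : HasDerivAt (fun v => 1 - ∫ t in (1 : ℝ)..v, g t) (-(g u)) u := by
    simpa using (intervalIntegral.integral_hasDerivAt_right (hgc.intervalIntegrable 1 u)
      (hgc.stronglyMeasurableAtFilter _ _) hgc.continuousAt).const_sub 1
  have h3 : g u = dickman (u - 1) / u := by
    simp only [hg]
    rw [max_eq_left hu.le, dickman_max_eq (by linarith)]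
  rw [← h3]
  refine h2.congr_of_eventuallyEq ?_
  filter_upwards [Ioi_mem_nhds hu] with v hv using h1 v (le_of_lt hv)

/-- Both sides equal `1` at `u = 1` and have the same derivative `ρ(u) - ρ(u - 1)` beyond. -/
theorem mul_dickman_eq_integral {u : ℝ} (hu : 1 < u) :
    u * dickman u = ∫ t in (u - 1)..u, dickman (max t 0) := by
  set d : ℝ → ℝ := fun t => dickman (max t 0) with hd
  have hdc : Continuous d := continuous_dickman_max
  have hdi : ∀ a b, IntervalIntegrable d volume a b := fun a b => hdc.intervalIntegrable a b
  set P : ℝ → ℝ := fun v => ∫ t in (0 : ℝ)..v, d t with hP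
  have hPd : ∀ v, HasDerivAt P (d v) v := fun v =>
    intervalIntegral.integral_hasDerivAt_right (hdi 0 v) (hdc.stronglyMeasurableAtFilter _ _)
      hdc.continuousAt
  have hPc : Continuous P := continuous_iff_continuousAt.mpr fun v => (hPd v).continuousAt
  set H : ℝ → ℝ := fun v => v * dickman v - (P v - P (v - 1)) with hH
  have hHc : ContinuousOn H (Set.Icc 1 u) := by
    refine ContinuousOn.sub (continuousOn_id.mul (continuousOn_dickman.mono fun v hv => ?_))
      (by fun_prop)
    exact zero_le_one.trans hv.1
  have hHd : ∀ v ∈ Set.Ioo 1 u, HasDerivAt H 0 v := by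
    intro v hv
    have h1 := (hasDerivAt_id v).mul (hasDerivAt_dickman hv.1)
    have h2 : HasDerivAt (fun v => P (v - 1)) (d (v - 1)) v := by
      exact ((hPd (v - 1)).comp v ((hasDerivAt_id v).sub_const 1)).congr_deriv (mul_one _)
    refine (h1.sub ((hPd v).sub h2)).congr_deriv ?_
    have hv0 : v ≠ 0 := by linarith [hv.1]
    simp only [hd, id]
    rw [dickman_max_eq (by linarith [hv.1]), dickman_max_eq (by linarith [hv.1])]
    field_simp
    ring
  obtain ⟨c, -, hc⟩ := exists_hasDerivAt_eq_slope H (fun _ => 0) hu hHc hHd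
  have hH1 : H 1 = 0 := by
    have : P 1 = 1 := by
      have : P 1 = ∫ t in (0 : ℝ)..1, (1 : ℝ) := by
        refine intervalIntegral.integral_congr fun t ht => ?_
        rw [Set.uIcc_of_le zero_le_one] at ht
        simp only [hd]
        rw [dickman_max_eq ht.1, dickman_of_le_one t ht.1 ht.2]
      simpa using this
    simp only [hH]
    rw [dickman_of_le_one 1 zero_le_one le_rfl, this]
    simp [hP]
  have hHu : H u = 0 := by
    rw [eq_comm, div_eq_zero_iff] at hc
    rcases hc with h | h <;> linarith
  have h4 : P u - P (u - 1) = ∫ t in (u - 1)..u, d t :=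
    intervalIntegral.integral_interval_sub_left (hdi _ _) (hdi _ _)
  rw [← h4]
  linarith [hHu]

/-- At the first point `w` where positivity fails, `w ρ(w)` would be the integral of a function
positive on `(w - 1, w)`. Positivity ensures that `ENNReal.ofReal` truncates nothing. -/
theorem dickman_pos {u : ℝ} (hu : 0 ≤ u) : 0 < dickman u := by
  by_contra hneg
  set Z : Set ℝ := Set.Ici 0 ∩ {v | dickman (max v 0) ≤ 0} with hZ
  have hZc : IsClosed Z := isClosed_Ici.inter (isClosed_le continuous_dickman_max continuous_const)
  have hZb : BddBelow Z := ⟨0, fun v hv => hv.1⟩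
  have hZn : Z.Nonempty := ⟨u, hu, by simpa [dickman_max_eq hu] using not_lt.mp hneg⟩
  have hw := hZc.csInf_mem hZn hZb
  set w := sInf Z
  have hw0 : 0 ≤ w := hw.1
  have hw1 : dickman w ≤ 0 := by simpa [dickman_max_eq hw0] using hw.2
  have hw2 : 1 < w := by
    by_contra h
    rw [dickman_of_le_one w hw0 (not_lt.mp h)] at hw1
    linarith
  have h1 := mul_dickman_eq_integral hw2
  have h2 : 0 < ∫ t in (w - 1)..w, dickman (max t 0) := by
    refine intervalIntegral.intervalIntegral_pos_of_pos_on
      (continuous_dickman_max.intervalIntegrable _ _) (fun t ht => ?_) (by linarith)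
    by_contra h
    have := csInf_le hZb (show t ∈ Z from ⟨(by linarith [ht.1] : (0 : ℝ) ≤ t), not_lt.mp h⟩)
    linarith [ht.2]
  nlinarith

/-- The integrand is the derivative of `s ↦ ρ(T / s)`. -/
theorem integral_dickman_div_sub_one {y T : ℝ} (hy : 0 < y) (hyT : y ≤ T) :
    ∫ s in y..T, s⁻¹ * dickman (max (T / s - 1) 0) = 1 - dickman (T / y) := by
  have hT : 0 < T := hy.trans_le hyT
  have h1 : dickman (T / T) = 1 := by
    rw [div_self hT.ne', dickman_of_le_one 1 zero_le_one le_rfl]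
  rw [show 1 - dickman (T / y) = dickman (T / T) - dickman (T / y) by rw [h1]]
  have hne : ∀ s ∈ Set.Icc y T, s ≠ 0 := fun s hs => (hy.trans_le hs.1).ne'
  have hdiv : ContinuousOn (fun s : ℝ => T / s) (Set.Icc y T) :=
    continuousOn_const.div continuousOn_id hne
  refine intervalIntegral.integral_eq_sub_of_hasDerivAt_of_le (f := fun s => dickman (T / s)) hyT
    ?_ (fun s hs => ?_) ?_
  · exact continuousOn_dickman.comp hdiv fun s hs => (div_pos hT (hy.trans_le hs.1)).le
  · have hs0 : 0 < s := hy.trans hs.1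
    have hs1 : 1 < T / s := (one_lt_div hs0).mpr hs.2
    have h2 : HasDerivAt (fun s : ℝ => T / s) (-T / s ^ 2) s := by
      simpa [div_eq_mul_inv, neg_mul] using (hasDerivAt_inv hs0.ne').const_mul T
    refine ((hasDerivAt_dickman hs1).comp s h2).congr_deriv ?_
    rw [dickman_max_eq (by linarith)]
    field_simp
  · refine ContinuousOn.intervalIntegrable ?_
    rw [Set.uIcc_of_le hyT]
    refine (continuousOn_inv₀.mono fun s hs => hne s hs).mul ?_
    exact continuous_dickman_max.comp_continuousOn (hdiv.sub continuousOn_const)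

/-- The analytic counterpart of `topIndicator_add_tsum`: with mass `T` left, `s` is the largest
remaining point if one exceeds `y`, and `ρ(T / y)` accounts for none doing so. -/
theorem lintegral_dickman_add {y T : ℝ} (hy : 0 < y) (hT : 0 < T) :
    (∫⁻ s in Set.Ioo 0 T, (Set.Ioi y).indicator
        (fun s => (ENNReal.ofReal s)⁻¹ * ENNReal.ofReal (dickman ((T - s) / s))) s) +
      ENNReal.ofReal (dickman (T / y)) = 1 := by
  rw [lintegral_indicator measurableSet_Ioi, Measure.restrict_restrict measurableSet_Ioi]
  rcases le_or_gt T y with h | h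
  · have h1 : Set.Ioi y ∩ Set.Ioo 0 T = ∅ := by
      ext s
      simp only [Set.mem_inter_iff, Set.mem_Ioi, Set.mem_Ioo, Set.mem_empty_iff_false, iff_false]
      intro hs
      linarith [hs.1, hs.2.2]
    rw [h1, dickman_of_le_one _ (by positivity) ((div_le_one hy).mpr h)]
    simp
  · have h1 : Set.Ioi y ∩ Set.Ioo 0 T = Set.Ioo y T := by
      ext s
      simp only [Set.mem_inter_iff, Set.mem_Ioi, Set.mem_Ioo]
      exact ⟨fun hs => ⟨hs.1, hs.2.2⟩, fun hs => ⟨hs.1, hy.trans hs.1, hs.2⟩⟩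
    have h2 := integral_dickman_div_sub_one hy h.le
    have hpos : ∀ s ∈ Set.Icc y T, 0 ≤ s⁻¹ * dickman (max (T / s - 1) 0) := fun s hs =>
      mul_nonneg (inv_nonneg.mpr (hy.le.trans hs.1)) (dickman_pos (le_max_right _ _)).le
    have hcont : ContinuousOn (fun s : ℝ => s⁻¹ * dickman (max (T / s - 1) 0)) (Set.Icc y T) := by
      refine (continuousOn_inv₀.mono fun s hs => (hy.trans_le hs.1).ne').mul ?_
      exact continuous_dickman_max.comp_continuousOn ((continuousOn_const.div continuousOn_id
        fun s hs => (hy.trans_le hs.1).ne').sub continuousOn_const)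
    have h3 : ∫⁻ s in Set.Ioo y T, (ENNReal.ofReal s)⁻¹ * ENNReal.ofReal (dickman ((T - s) / s)) =
        ENNReal.ofReal (1 - dickman (T / y)) := by
      rw [← h2, intervalIntegral.integral_of_le h.le, integral_Ioc_eq_integral_Ioo,
        ofReal_integral_eq_lintegral_ofReal]
      · refine setLIntegral_congr_fun measurableSet_Ioo fun s hs => ?_
        have hs0 : 0 < s := hy.trans hs.1
        have hs1 : (T - s) / s = T / s - 1 := by field_simp
        have hs2 : 0 ≤ T / s - 1 := sub_nonneg.mpr ((one_le_div hs0).mpr hs.2.le)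
        rw [ENNReal.ofReal_mul (inv_nonneg.mpr hs0.le), ENNReal.ofReal_inv_of_pos hs0,
          dickman_max_eq hs2, hs1]
      · exact (hcont.integrableOn_Icc).mono_set Set.Ioo_subset_Icc_self
      · exact (ae_restrict_mem measurableSet_Ioo).mono fun s hs =>
          hpos s (Set.Ioo_subset_Icc_self hs)
    have h4 : 0 ≤ 1 - dickman (T / y) := by
      rw [← h2]
      exact intervalIntegral.integral_nonneg h.le hpos
    rw [h1, h3, ← ENNReal.ofReal_add h4 (dickman_pos (by positivity)).le]
    simp

/-! ### Almost sure properties of the limit -/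

/-- The strictly decreasing sequences of positive numbers with sum `1`. -/
def strictSimplex : Set (ℕ → ℝ) := {x | StrictAnti x ∧ (∀ i, 0 < x i) ∧ HasSum x 1}

theorem comp_mem_tupleSimplex {x : ℕ → ℝ} (hx : x ∈ strictSimplex) {k : ℕ} (e : Fin k ↪ ℕ) :
    (fun i => x (e i)) ∈ tupleSimplex k := by
  refine ⟨fun i => hx.2.1 _, ?_⟩
  obtain ⟨j, hj⟩ : ∃ j, j ∉ Finset.univ.map e := Infinite.exists_notMem_finset _
  have h1 := sum_le_hasSum (insert j (Finset.univ.map e)) (fun i _ => (hx.2.1 i).le) hx.2.2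
  rw [Finset.sum_insert hj, Finset.sum_map] at h1
  linarith [hx.2.1 j]

section SizeBiased

variable {μ : Measure (ℕ → ℝ)}

theorem ae_of_ae_tupleSimplex {k : ℕ}
    (hsb : sizeBiased μ k = volume.restrict (tupleSimplex k)) {p : (Fin k → ℝ) → Prop}
    (hp : MeasurableSet {t | p t}) (h : ∀ᵐ t ∂(volume.restrict (tupleSimplex k)), p t) :
    ∀ᵐ x ∂μ, ∀ e : Fin k ↪ ℕ, (∀ i, 0 < x (e i)) → p fun i => x (e i) := by
  have h1 : ∫⁻ t, {t | p t}ᶜ.indicator 1 t ∂(sizeBiased μ k) = 0 := by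
    rw [hsb, lintegral_indicator_one hp.compl]
    exact ae_iff.mp h
  have hm : Measurable ({t | p t}ᶜ.indicator (1 : (Fin k → ℝ) → ℝ≥0∞)) :=
    measurable_one.indicator hp.compl
  rw [lintegral_sizeBiased _ hm, lintegral_eq_zero_iff (by fun_prop)] at h1
  filter_upwards [h1] with x hx e he
  by_contra hne
  have h2 := ENNReal.tsum_eq_zero.mp hx e
  rw [Set.indicator_of_mem (by exact hne), Pi.one_apply, mul_one, Finset.prod_eq_zero_iff] at h2
  obtain ⟨i, -, hi⟩ := h2
  exact (ENNReal.ofReal_pos.mpr (he i)).ne' hi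

variable [IsProbabilityMeasure μ]

/-- The total of the points is at most `1`, and its mean is the mass of `sizeBiased μ 1`, which is
the length `1` of the unit interval. -/
theorem ae_hasSum_one (hS : ∀ᵐ x ∂μ, x ∈ sortedSimplex)
    (hsb : sizeBiased μ 1 = volume.restrict (tupleSimplex 1)) : ∀ᵐ x ∂μ, HasSum x 1 := by
  have h0 : tupleSimplex 0 = Set.univ := by ext t; simp [tupleSimplex]
  have h1 : ∫⁻ x, ∑' j, ENNReal.ofReal (x j) ∂μ = 1 := by
    have h2 : sizeBiased μ 1 Set.univ = 1 := by
      rw [hsb, Measure.restrict_apply_univ, volume_tupleSimplex_succ, h0, Measure.restrict_univ,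
        volume_pi, Measure.pi_of_empty _ 0, lintegral_dirac]
      simp
    rw [← h2, ← lintegral_one, lintegral_sizeBiased _ measurable_const]
    refine lintegral_congr fun x => ?_
    rw [tsum_embedding_succ fun e => (∏ i, ENNReal.ofReal (x (e i))) * 1,
      tsum_eq_single (default : Fin 0 ↪ ℕ) fun e he => absurd (Subsingleton.elim _ _) he,
      ← sum_add_tsum_notMem_range _ (default : Fin 0 ↪ ℕ)]
    simp
  have h2 : ∀ᵐ x ∂μ, ∑' j, ENNReal.ofReal (x j) = 1 := by
    refine ae_eq_of_ae_le_of_lintegral_le (hS.mono fun x hx => tsum_ofReal_le_one hx)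
      (by rw [h1]; simp) aemeasurable_const (by rw [h1]; simp)
  filter_upwards [hS, h2] with x hx hx2
  have h3 := ENNReal.hasSum_toReal (f := fun j => ENNReal.ofReal (x j)) (by rw [hx2]; simp)
  simp only [ENNReal.toReal_ofReal (hx.2.1 _)] at h3
  have h4 : ∑' j, x j = 1 := by
    have := ENNReal.tsum_toReal_eq (f := fun j => ENNReal.ofReal (x j)) (by simp)
    simp only [ENNReal.toReal_ofReal (hx.2.1 _), hx2] at this
    simpa using this.symm
  rwa [h4] at h3

/-- Ties between positive points lie on a Lebesgue-null diagonal. If some point vanished, the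
finitely many positive ones would sum to `1`, whereas tuples of positive points almost surely lie in
the open simplex. -/
theorem ae_mem_strictSimplex (hS : ∀ᵐ x ∂μ, x ∈ sortedSimplex)
    (hsb : ∀ k, sizeBiased μ k = volume.restrict (tupleSimplex k)) :
    ∀ᵐ x ∂μ, x ∈ strictSimplex := by
  have h1 : ∀ᵐ x ∂μ, ∀ e : Fin 2 ↪ ℕ, (∀ i, 0 < x (e i)) → x (e 0) ≠ x (e 1) := by
    refine ae_of_ae_tupleSimplex (hsb 2) (p := fun t => t 0 ≠ t 1)
      (measurableSet_eq_fun (by fun_prop) (by fun_prop)).compl ?_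
    filter_upwards [ae_restrict_of_ae (ae_injective 2)] with t ht h
    exact absurd (ht h) (by simp)
  have h2 : ∀ᵐ x ∂μ, ∀ (k : ℕ) (e : Fin k ↪ ℕ), (∀ i, 0 < x (e i)) →
      (fun i => x (e i)) ∈ tupleSimplex k := by
    rw [ae_all_iff]
    exact fun k => ae_of_ae_tupleSimplex (hsb k) (measurableSet_tupleSimplex k)
      (ae_restrict_mem (measurableSet_tupleSimplex k))
  filter_upwards [hS, ae_hasSum_one hS (hsb 1), h1, h2] with x hx hsum htie hlt
  have hpos : ∀ i, 0 < x i := by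
    by_contra! hne
    classical
    have hK := Nat.find_spec hne
    set K := Nat.find hne
    have hK' : ∀ i < K, 0 < x i := fun i hi => not_le.mp (Nat.find_min hne hi)
    have h3 := hasSum_sum_of_ne_finset_zero (L := .unconditional ℕ) (f := x)
      (s := Finset.range K) fun i hi =>
      le_antisymm ((hx.1 (by simpa using hi)).trans hK) (hx.2.1 i)
    have h4 := (hlt K Fin.valEmbedding fun i => hK' i i.2).2
    rw [Finset.sum_range] at h3
    have h5 := h3.unique hsum
    simp only [Fin.valEmbedding_apply] at h4
    linarith
  refine ⟨fun i j hij => lt_of_le_of_ne (hx.1 hij.le) fun h => ?_, hpos, hsum⟩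
  have hinj : Function.Injective ![i, j] := by
    intro a b
    fin_cases a <;> fin_cases b <;> simp [hij.ne, hij.ne']
  exact htie ⟨![i, j], hinj⟩ (fun _ => hpos _) (by simpa using h.symm)

end SizeBiased

/-! ### Densities of the largest points -/

open Classical in
/-- The indicator of the event that the points `x j` with `j` outside the range of `e` are at
most `c`. -/
noncomputable def topIndicator {k : ℕ} (e : Fin k → ℕ) (c : ℝ) (x : ℕ → ℝ) : ℝ≥0∞ :=
  if ∀ j ∉ Set.range e, x j ≤ c then 1 else 0

theorem measurable_topIndicator {k : ℕ} (e : Fin k → ℕ) {y : (ℕ → ℝ) → ℝ} (hy : Measurable y) :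
    Measurable fun x => topIndicator e (y x) x := by
  refine Measurable.ite ?_ measurable_const measurable_const
  simp only [Set.ofPred_forall]
  exact MeasurableSet.iInter fun j => MeasurableSet.iInter fun _ =>
    measurableSet_le (measurable_pi_apply j) hy

/-- Either no point outside `e` exceeds `c`, or exactly one `j` contributes to the sum: the place of
the largest such point, which is the first place missed by `e`. -/
theorem topIndicator_add_tsum {x : ℕ → ℝ} (hx : StrictAnti x) {k : ℕ} (e : Fin k ↪ ℕ) (c : ℝ) :
    topIndicator e c x + ∑' j : {j // j ∉ Set.range e},
      (Set.Ioi c).indicator 1 (x j) * topIndicator (Fin.cons (j : ℕ) e : Fin (k + 1) → ℕ) (x j) x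
      = 1 := by
  classical
  by_cases h : ∀ j ∉ Set.range e, x j ≤ c
  · have h1 : ∀ j : {j // j ∉ Set.range e}, (Set.Ioi c).indicator (1 : ℝ → ℝ≥0∞) (x j) = 0 :=
      fun j => Set.indicator_of_notMem (not_lt.mpr (h j j.2)) _
    rw [topIndicator, if_pos h]
    simp [h1]
  · have hex : ∃ j, j ∉ Set.range e := by
      push Not at h
      exact ⟨h.choose, h.choose_spec.1⟩
    have hj0 := Nat.find_spec hex
    have hmin : ∀ j, j ∉ Set.range e → Nat.find hex ≤ j := fun j hj => Nat.find_min' hex hj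
    set j0 := Nat.find hex
    have hc : c < x j0 := by
      push Not at h
      obtain ⟨l, hl, hcl⟩ := h
      exact hcl.trans_le (hx.antitone (hmin l hl))
    rw [topIndicator, if_neg h, zero_add, tsum_eq_single ⟨j0, hj0⟩]
    · rw [Set.indicator_of_mem (show x j0 ∈ Set.Ioi c from hc), topIndicator, if_pos,
        Pi.one_apply, one_mul]
      intro j hj
      rw [Fin.range_cons, Set.mem_insert_iff, not_or] at hj
      exact hx.antitone (hmin j hj.2)
    · rintro ⟨j, hj⟩ hne
      have hlt : j0 < j := lt_of_le_of_ne (hmin j hj) fun h => hne (by simp [h])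
      rw [topIndicator, if_neg, mul_zero]
      intro hall
      refine absurd (hall j0 ?_) (not_le.mpr (hx hlt))
      rw [Fin.range_cons, Set.mem_insert_iff, not_or]
      exact ⟨hlt.ne, hj0⟩

theorem measurable_dickman : Measurable dickman := by
  have h : dickman = fun u => if u < 0 then 0 else dickman (max u 0) := by
    funext u
    rcases lt_or_ge u 0 with h | h
    · rw [if_pos h, dickman, if_pos h]
    · rw [if_neg (not_lt.mpr h), dickman_max_eq h]
  rw [h]
  exact Measurable.ite measurableSet_Iio measurable_const continuous_dickman_max.measurable

/-- The intensity of the tuples of points that exceed all the other points, up to a threshold that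
may depend on the tuple, is given by the Dickman function. -/
theorem lintegral_tsum_topIndicator {μ : Measure (ℕ → ℝ)}
    (hμ : ∀ᵐ x ∂μ, x ∈ strictSimplex)
    (hsb : ∀ k, sizeBiased μ k = volume.restrict (tupleSimplex k)) (n : ℕ) :
    ∀ {k : ℕ} {G : (Fin k → ℝ) → ℝ≥0∞} {y : (Fin k → ℝ) → ℝ}, Measurable G → Measurable y →
      (∀ t, G t ≠ 0 → 0 < y t) → (∀ t, G t ≠ 0 → 1 - ∑ i, t i ≤ n * y t) →
      ∫⁻ t in tupleSimplex k, G t ≠ ∞ →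
      ∫⁻ x, ∑' e : Fin k ↪ ℕ, (∏ i, ENNReal.ofReal (x (e i))) * (G (fun i => x (e i)) *
          topIndicator e (y fun i => x (e i)) x) ∂μ =
        ∫⁻ t in tupleSimplex k, G t * ENNReal.ofReal (dickman ((1 - ∑ i, t i) / y t)) := by
  -- `n` bounds the remaining mass divided by the threshold, on the support of `G`. For `n = 0` no
  -- mass would remain, so `G` vanishes on the open simplex.
  induction n with
  | zero =>
    intro k G y hG hy hpos hsupp hfin
    have h0 : ∀ t ∈ tupleSimplex k, G t = 0 := by
      intro t ht
      by_contra h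
      have := hsupp t h
      simp only [Nat.cast_zero, zero_mul] at this
      linarith [ht.2]
    rw [lintegral_eq_zero_of_ae_eq_zero, setLIntegral_eq_zero (measurableSet_tupleSimplex k)]
    · intro t ht
      simp [h0 t ht]
    · filter_upwards [hμ] with x hx
      simp [h0 _ (comp_mem_tupleSimplex hx _)]
  | succ n ih =>
    intro k G y hG hy hpos hsupp hfin
    -- The new point `t 0` exceeds the old threshold and becomes the new one; its inverse cancels
    -- its size-bias weight.
    set G' : (Fin (k + 1) → ℝ) → ℝ≥0∞ := fun t => (ENNReal.ofReal (t 0))⁻¹ *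
      (G (fun i => t i.succ) * (Set.Ioi (y fun i => t i.succ)).indicator 1 (t 0)) with hG'
    have hind : Measurable fun p : ℝ × ℝ => (Set.Ioi p.1).indicator (1 : ℝ → ℝ≥0∞) p.2 := by
      have : (fun p : ℝ × ℝ => (Set.Ioi p.1).indicator (1 : ℝ → ℝ≥0∞) p.2) =
          {p : ℝ × ℝ | p.1 < p.2}.indicator 1 := by
        funext p; simp [Set.indicator_apply]
      rw [this]
      exact measurable_one.indicator (measurableSet_lt measurable_fst measurable_snd)
    have htail : Measurable fun (t : Fin (k + 1) → ℝ) (i : Fin k) => t i.succ := by fun_prop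
    have hG'm : Measurable G' := by
      refine Measurable.mul (by fun_prop) ((hG.comp htail).mul ?_)
      exact hind.comp ((hy.comp htail).prodMk (measurable_pi_apply 0))
    have hne : ∀ t, G' t ≠ 0 → G (fun i => t i.succ) ≠ 0 ∧ y (fun i => t i.succ) < t 0 := by
      intro t ht
      have h1 := right_ne_zero_of_mul ht
      refine ⟨left_ne_zero_of_mul h1, ?_⟩
      by_contra h
      exact right_ne_zero_of_mul h1 (Set.indicator_of_notMem h _)
    have hG'cons : ∀ (s : ℝ) (t : Fin k → ℝ), G' (Fin.cons s t) =
        (ENNReal.ofReal s)⁻¹ * (G t * (Set.Ioi (y t)).indicator 1 s) := fun s t => rfl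
    have hfin' : ∫⁻ t in tupleSimplex (k + 1), G' t ≠ ∞ := by
      rw [setLIntegral_tupleSimplex_succ hG'm]
      have hb : ∀ t ∈ tupleSimplex k, ∫⁻ s in Set.Ioo 0 (1 - ∑ i, t i), G' (Fin.cons s t) ≤
          (n + 1 : ℕ) * G t := by
        intro t ht
        by_cases hGt : G t = 0
        · simp [hG'cons, hGt]
        have hyt := hpos t hGt
        calc ∫⁻ s in Set.Ioo 0 (1 - ∑ i, t i), G' (Fin.cons s t)
            ≤ ∫⁻ s in Set.Ioo 0 (1 - ∑ i, t i), (ENNReal.ofReal (y t))⁻¹ * G t := by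
              refine lintegral_mono fun s => ?_
              rw [hG'cons]
              by_cases hs : s ∈ Set.Ioi (y t)
              · rw [Set.indicator_of_mem hs, Pi.one_apply, mul_one]
                gcongr
                exact le_of_lt hs
              · simp [Set.indicator_of_notMem hs]
          _ = ENNReal.ofReal (1 - ∑ i, t i) * (ENNReal.ofReal (y t))⁻¹ * G t := by
              rw [lintegral_const, Measure.restrict_apply_univ, Real.volume_Ioo, sub_zero]
              ring
          _ ≤ _ := by
              gcongr
              rw [← div_eq_mul_inv]
              refine ENNReal.div_le_of_le_mul ?_
              rw [← ENNReal.ofReal_natCast, ← ENNReal.ofReal_mul (Nat.cast_nonneg _)]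
              exact ENNReal.ofReal_le_ofReal (hsupp t hGt)
      refine ((setLIntegral_mono' (measurableSet_tupleSimplex k) hb).trans_lt ?_).ne
      rw [lintegral_const_mul _ hG]
      exact ENNReal.mul_lt_top (by simp) hfin.lt_top
    -- Since `t 0 > y`, the mass left is at most `(n + 1) y - t 0 ≤ n * t 0`.
    have hIH := ih (k := k + 1) (G := G') (y := fun t => t 0) hG'm (by fun_prop)
      (fun t ht => (hpos _ (hne t ht).1).trans (hne t ht).2) (fun t ht => by
        have h1 := hsupp _ (hne t ht).1
        have h2 := (hne t ht).2
        rw [Fin.sum_univ_succ]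
        push_cast at h1
        nlinarith [(Nat.cast_nonneg n : (0 : ℝ) ≤ n)]) hfin'
    have hR : (∫⁻ t in tupleSimplex (k + 1),
          G' t * ENNReal.ofReal (dickman ((1 - ∑ i, t i) / t 0))) +
        ∫⁻ t in tupleSimplex k, G t * ENNReal.ofReal (dickman ((1 - ∑ i, t i) / y t)) =
        ∫⁻ t in tupleSimplex k, G t := by
      have hmR : Measurable fun t : Fin (k + 1) → ℝ =>
          ENNReal.ofReal (dickman ((1 - ∑ i, t i) / t 0)) :=
        (measurable_dickman.comp (by fun_prop)).ennreal_ofReal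
      have hm2 : Measurable fun t : Fin k → ℝ =>
          ENNReal.ofReal (dickman ((1 - ∑ i, t i) / y t)) :=
        (measurable_dickman.comp (by fun_prop)).ennreal_ofReal
      rw [setLIntegral_tupleSimplex_succ (f := fun t => G' t * _) (hG'm.mul hmR),
        ← lintegral_add_right (g := fun t => G t * _) _ (hG.mul hm2)]
      refine setLIntegral_congr_fun (measurableSet_tupleSimplex k) fun t ht => ?_
      by_cases hGt : G t = 0
      · simp [hG'cons, hGt]
      have hT : 0 < 1 - ∑ i, t i := by linarith [ht.2]
      have hint : ∀ s : ℝ, G' (Fin.cons s t) * ENNReal.ofReal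
          (dickman ((1 - ∑ i, (Fin.cons s t : Fin (k + 1) → ℝ) i) /
            (Fin.cons s t : Fin (k + 1) → ℝ) 0)) = G t * (Set.Ioi (y t)).indicator
          (fun s => (ENNReal.ofReal s)⁻¹ *
            ENNReal.ofReal (dickman ((1 - ∑ i, t i - s) / s))) s := by
        intro s
        rw [hG'cons, Fin.sum_univ_succ]
        simp only [Fin.cons_zero, Fin.cons_succ]
        by_cases hs : s ∈ Set.Ioi (y t)
        · rw [Set.indicator_of_mem hs, Set.indicator_of_mem hs, Pi.one_apply, mul_one,
            sub_add_eq_sub_sub_swap]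
          ring
        · simp [Set.indicator_of_notMem hs]
      have hm3 : Measurable ((Set.Ioi (y t)).indicator fun s : ℝ => (ENNReal.ofReal s)⁻¹ *
          ENNReal.ofReal (dickman ((1 - ∑ i, t i - s) / s))) := by
        refine Measurable.indicator ?_ measurableSet_Ioi
        exact Measurable.mul (by fun_prop) (measurable_dickman.comp (by fun_prop)).ennreal_ofReal
      simp only [hint]
      rw [lintegral_const_mul _ hm3, ← mul_add, lintegral_dickman_add (hpos t hGt) hT, mul_one]
    have hL : (∫⁻ x, ∑' e : Fin (k + 1) ↪ ℕ, (∏ i, ENNReal.ofReal (x (e i))) *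
          (G' (fun i => x (e i)) * topIndicator e (x (e 0)) x) ∂μ) +
        ∫⁻ x, ∑' e : Fin k ↪ ℕ, (∏ i, ENNReal.ofReal (x (e i))) * (G (fun i => x (e i)) *
          topIndicator e (y fun i => x (e i)) x) ∂μ =
        ∫⁻ t in tupleSimplex k, G t := by
      have hm1 : Measurable fun x : ℕ → ℝ => ∑' e : Fin (k + 1) ↪ ℕ,
          (∏ i, ENNReal.ofReal (x (e i))) *
            (G' (fun i => x (e i)) * topIndicator e (x (e 0)) x) :=
        Measurable.tsum fun e => Measurable.mul (by fun_prop)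
          (Measurable.mul (by fun_prop) (measurable_topIndicator e (measurable_pi_apply _)))
      rw [← lintegral_add_left hm1, ← hsb k, lintegral_sizeBiased _ hG]
      refine lintegral_congr_ae ?_
      filter_upwards [hμ] with x hx
      rw [tsum_embedding_succ fun e => (∏ i, ENNReal.ofReal (x (e i))) *
        (G' (fun i => x (e i)) * topIndicator e (x (e 0)) x), ← ENNReal.tsum_add]
      refine tsum_congr fun e => ?_
      have hterm : ∀ j : ℕ, (∏ i, ENNReal.ofReal (x ((Fin.cons j e : Fin (k + 1) → ℕ) i))) *
          (G' (fun i => x ((Fin.cons j e : Fin (k + 1) → ℕ) i)) *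
            topIndicator (Fin.cons j e : Fin (k + 1) → ℕ)
              (x ((Fin.cons j e : Fin (k + 1) → ℕ) 0)) x) =
          (∏ i, ENNReal.ofReal (x (e i))) * G (fun i => x (e i)) *
            ((Set.Ioi (y fun i => x (e i))).indicator 1 (x j) *
              topIndicator (Fin.cons j e : Fin (k + 1) → ℕ) (x j) x) := by
        intro j
        have hj : ENNReal.ofReal (x j) * (ENNReal.ofReal (x j))⁻¹ = 1 :=
          ENNReal.mul_inv_cancel (ENNReal.ofReal_pos.mpr (hx.2.1 j)).ne' ENNReal.ofReal_ne_top
        rw [cons_comp_eq, hG'cons, Fin.prod_univ_succ]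
        simp only [Fin.cons_zero, Fin.cons_succ]
        calc _ = (ENNReal.ofReal (x j) * (ENNReal.ofReal (x j))⁻¹) *
              ((∏ i, ENNReal.ofReal (x (e i))) * G (fun i => x (e i)) *
                ((Set.Ioi (y fun i => x (e i))).indicator 1 (x j) *
                  topIndicator (Fin.cons j e : Fin (k + 1) → ℕ) (x j) x)) := by ring
          _ = _ := by rw [hj, one_mul]
      simp only [hterm]
      rw [ENNReal.tsum_mul_left, ← mul_assoc, ← mul_add, add_comm, topIndicator_add_tsum hx.1,
        mul_one]
    -- `hL` and `hR` split the same integral of `G`, and the induction hypothesis identifies their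
    -- first terms. Finiteness of that integral permits cancellation in `ℝ≥0∞`.
    rw [hIH, ← hR] at hL
    refine (ENNReal.add_right_inj ?_).mp hL
    refine ne_top_of_le_ne_top hfin ?_
    rw [← hR]
    exact le_self_add

theorem measurableSet_pdSupport (k : ℕ) : MeasurableSet (pdSupport k) := by
  have h : pdSupport k = (⋂ i, ⋂ j, ⋂ (_ : i < j), {t : Fin (k + 1) → ℝ | t j < t i}) ∩
      ({t | 0 < t (Fin.last k)} ∩ {t | ∑ i, t i < 1}) := by
    ext t; simp [pdSupport, StrictAnti]
  rw [h]
  refine MeasurableSet.inter ?_ ((measurableSet_lt measurable_const (by fun_prop)).inter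
    (measurableSet_lt (by fun_prop) measurable_const))
  exact MeasurableSet.iInter fun i => MeasurableSet.iInter fun j => MeasurableSet.iInter fun _ =>
    measurableSet_lt (measurable_pi_apply j) (measurable_pi_apply i)

theorem pdSupport_subset_tupleSimplex (k : ℕ) : pdSupport k ⊆ tupleSimplex (k + 1) :=
  fun _ ht => ⟨fun i => ht.2.1.trans_le (ht.1.antitone (Fin.le_last i)), ht.2.2⟩

theorem continuous_firstCoords (k : ℕ) : Continuous (firstCoords k) :=
  continuous_pi fun i => continuous_apply (i : ℕ)

theorem measurable_firstCoords (k : ℕ) : Measurable (firstCoords k) :=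
  (continuous_firstCoords k).measurable

theorem firstCoords_mem_pdSupport {x : ℕ → ℝ} (hx : x ∈ strictSimplex) (k : ℕ) :
    firstCoords k x ∈ pdSupport k :=
  ⟨fun _ _ hij => hx.1 hij, hx.2.1 _, (comp_mem_tupleSimplex hx Fin.valEmbedding).2⟩

theorem volume_tupleSimplex_lt_top (k : ℕ) : volume (tupleSimplex k) < ∞ := by
  refine lt_of_le_of_lt (measure_mono fun t ht => ?_)
    (isCompact_Icc (a := (0 : Fin k → ℝ)) (b := 1)).measure_lt_top
  exact ⟨fun i => (ht.1 i).le, fun i =>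
    (Finset.single_le_sum (fun j _ => (ht.1 j).le) (Finset.mem_univ i)).trans ht.2.le⟩

/-- The first `k + 1` places are the only ones, in decreasing order of the points, that carry
points which exceed all the other points. -/
theorem eq_valEmbedding_of_forall_le {x : ℕ → ℝ} (hx : StrictAnti x) {k : ℕ}
    {e : Fin (k + 1) ↪ ℕ} (he : StrictAnti fun i => x (e i))
    (htop : ∀ j ∉ Set.range e, x j ≤ x (e (Fin.last k))) : e = Fin.valEmbedding := by
  have hmono : StrictMono e := fun i j hij => hx.lt_iff_gt.mp (he hij)
  have hrange : Finset.univ.map e = Finset.range (e (Fin.last k) + 1) := by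
    ext j
    rw [Finset.mem_map, Finset.mem_range, Nat.lt_succ_iff]
    constructor
    · rintro ⟨i, -, rfl⟩
      exact hmono.monotone (Fin.le_last i)
    · intro hj
      by_contra h
      have hj' : j ∉ Set.range e := fun ⟨i, hi⟩ => h ⟨i, Finset.mem_univ i, hi⟩
      have h1 : e (Fin.last k) ≤ j := hx.le_iff_ge.mp (htop j hj')
      exact hj' ⟨Fin.last k, le_antisymm h1 hj⟩
  have hcard : k + 1 = e (Fin.last k) + 1 := by
    simpa using congrArg Finset.card hrange
  have hval : StrictMono (Fin.valEmbedding : Fin (k + 1) ↪ ℕ) := fun i j hij => hij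
  refine DFunLike.coe_injective ((hmono.range_inj hval).mp ?_)
  have h1 := congrArg (fun s : Finset ℕ => (s : Set ℕ)) hrange
  simp only [Finset.coe_map, Finset.coe_univ, Set.image_univ] at h1
  rw [h1, ← hcard]
  ext j
  simp only [Finset.coe_range, Set.mem_Iio, Set.mem_range, Fin.valEmbedding_apply]
  exact ⟨fun h => ⟨⟨j, h⟩, rfl⟩, fun ⟨i, hi⟩ => hi ▸ i.2⟩

/-- Apply `lintegral_tsum_topIndicator` with the weight `1 / ∏ t i` on `B`, which undoes the size
bias, and with the smallest chosen point as threshold. Points of `B` are decreasing, so only the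
initial places survive in the sum. The bound by `n` keeps the weight bounded and starts the
induction. -/
theorem map_firstCoords_apply {μ : Measure (ℕ → ℝ)} (hμ : ∀ᵐ x ∂μ, x ∈ strictSimplex)
    (hsb : ∀ k, sizeBiased μ k = volume.restrict (tupleSimplex k)) (k n : ℕ)
    {B : Set (Fin (k + 1) → ℝ)} (hB : MeasurableSet B) (hBU : B ⊆ pdSupport k)
    (hBn : ∀ t ∈ B, 1 ≤ n * t (Fin.last k)) :
    μ.map (firstCoords k) B = ∫⁻ t in B, ENNReal.ofReal (pdDensity k t) := by
  set G : (Fin (k + 1) → ℝ) → ℝ≥0∞ := B.indicator fun t => ∏ i, (ENNReal.ofReal (t i))⁻¹ with hG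
  have hGm : Measurable G := Measurable.indicator (by fun_prop) hB
  have hGB : ∀ t, G t ≠ 0 → t ∈ B := fun t ht => Set.mem_of_indicator_ne_zero ht
  have hpos : ∀ t ∈ B, ∀ i, 0 < t i := fun t ht => (pdSupport_subset_tupleSimplex k (hBU ht)).1
  have hfin : ∫⁻ t in tupleSimplex (k + 1), G t ≠ ∞ := by
    refine (lt_of_le_of_lt (lintegral_mono (g := fun _ => (n : ℝ≥0∞) ^ (k + 1)) fun t => ?_)
      ?_).ne
    · by_cases ht : t ∈ B
      · rw [hG, Set.indicator_of_mem ht]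
        calc ∏ i, (ENNReal.ofReal (t i))⁻¹ ≤ ∏ i : Fin (k + 1), (n : ℝ≥0∞) := by
              gcongr with i
              rw [ENNReal.inv_le_iff_le_mul (by simp) (by simp), mul_comm,
                ← ENNReal.ofReal_natCast, ← ENNReal.ofReal_mul (Nat.cast_nonneg n),
                ← ENNReal.ofReal_one]
              refine ENNReal.ofReal_le_ofReal ((hBn t ht).trans ?_)
              gcongr
              exact (hBU ht).1.antitone (Fin.le_last i)
          _ = _ := by simp
      · rw [hG, Set.indicator_of_notMem ht]
        exact zero_le
    · rw [lintegral_const, Measure.restrict_apply_univ]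
      exact ENNReal.mul_lt_top (by simp) (volume_tupleSimplex_lt_top _)
  have hmain := lintegral_tsum_topIndicator hμ hsb n (G := G) (y := fun t => t (Fin.last k)) hGm
    (by fun_prop) (fun t ht => hpos t (hGB t ht) _) (fun t ht => by
      have h1 := hBn t (hGB t ht)
      have h2 : 0 ≤ ∑ i, t i := Finset.sum_nonneg fun i _ => (hpos t (hGB t ht) i).le
      linarith) hfin
  have hL : ∫⁻ x, ∑' e : Fin (k + 1) ↪ ℕ, (∏ i, ENNReal.ofReal (x (e i))) *
      (G (fun i => x (e i)) * topIndicator e (x (e (Fin.last k))) x) ∂μ =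
      μ.map (firstCoords k) B := by
    rw [← lintegral_indicator_one hB, lintegral_map (measurable_one.indicator hB)
      (measurable_firstCoords k)]
    refine lintegral_congr_ae ?_
    filter_upwards [hμ] with x hx
    have hcoord : (fun i => x ((Fin.valEmbedding : Fin (k + 1) ↪ ℕ) i)) = firstCoords k x := rfl
    rw [tsum_eq_single Fin.valEmbedding]
    · rw [hcoord, topIndicator, if_pos, mul_one]
      · by_cases hxB : firstCoords k x ∈ B
        · rw [hG, Set.indicator_of_mem hxB, Set.indicator_of_mem hxB, ← Finset.prod_mul_distrib,
            Pi.one_apply]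
          refine Finset.prod_eq_one fun i _ => ?_
          exact ENNReal.mul_inv_cancel (ENNReal.ofReal_pos.mpr (hx.2.1 _)).ne'
            ENNReal.ofReal_ne_top
        · rw [hG, Set.indicator_of_notMem hxB, Set.indicator_of_notMem hxB, mul_zero]
      · intro j hj
        refine hx.1.antitone ?_
        by_contra h
        exact hj ⟨⟨j, (not_le.mp h).trans (Nat.lt_succ_self k)⟩, rfl⟩
    · intro e hne
      by_cases hxB : (fun i => x (e i)) ∈ B
      · rw [topIndicator, if_neg, mul_zero, mul_zero]
        exact fun htop => hne (eq_valEmbedding_of_forall_le hx.1 (hBU hxB).1 htop)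
      · rw [hG, Set.indicator_of_notMem hxB, zero_mul, mul_zero]
  rw [← hL, hmain]
  have hG' : ∀ t, G t * ENNReal.ofReal (dickman ((1 - ∑ i, t i) / t (Fin.last k))) =
      B.indicator (fun t => ENNReal.ofReal (pdDensity k t)) t := by
    intro t
    by_cases ht : t ∈ B
    · rw [hG, Set.indicator_of_mem ht, Set.indicator_of_mem ht, pdDensity, if_pos (hBU ht),
        ENNReal.ofReal_mul (one_div_nonneg.mpr (Finset.prod_nonneg fun i _ => (hpos t ht i).le)),
        one_div, ← Finset.prod_inv_distrib, ENNReal.ofReal_prod_of_nonneg fun i _ =>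
          (inv_pos.mpr (hpos t ht i)).le]
      congr 1
      exact Finset.prod_congr rfl fun i _ => (ENNReal.ofReal_inv_of_pos (hpos t ht i)).symm
    · rw [hG, Set.indicator_of_notMem ht, Set.indicator_of_notMem ht, zero_mul]
  simp only [hG']
  rw [lintegral_indicator hB, Measure.restrict_restrict hB,
    Set.inter_eq_left.mpr (hBU.trans (pdSupport_subset_tupleSimplex k))]

theorem map_firstCoords_eq {μ : Measure (ℕ → ℝ)} (hμ : ∀ᵐ x ∂μ, x ∈ strictSimplex)
    (hsb : ∀ k, sizeBiased μ k = volume.restrict (tupleSimplex k)) (k : ℕ) :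
    μ.map (firstCoords k) =
      (volume : Measure (Fin (k + 1) → ℝ)).withDensity fun t => ENNReal.ofReal (pdDensity k t) := by
  have hU := measurableSet_pdSupport k
  set S : ℕ → Set (Fin (k + 1) → ℝ) :=
    fun n => (pdSupport k)ᶜ ∪ {t | 1 ≤ (n : ℝ) * t (Fin.last k)} with hS
  have hSm : ∀ n, MeasurableSet (S n) := fun n =>
    hU.compl.union (measurableSet_le measurable_const (by fun_prop))
  have hSU : ⋃ n, S n = Set.univ := by
    refine Set.eq_univ_of_forall fun t => Set.mem_iUnion.mpr ?_
    by_cases ht : t ∈ pdSupport k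
    · obtain ⟨n, hn⟩ := exists_nat_ge (1 / t (Fin.last k))
      exact ⟨n, Or.inr ((div_le_iff₀ ht.2.1).mp hn)⟩
    · exact ⟨0, Or.inl ht⟩
  -- Exhaust the space by sets where the smallest coordinate is at least `1 / n`, together with the
  -- complement of the support, which both measures ignore.
  refine (Measure.ext_iff_of_iUnion_eq_univ hSU).mpr fun n => Measure.ext fun B hB => ?_
  rw [Measure.restrict_apply hB, Measure.restrict_apply hB,
    withDensity_apply _ (hB.inter (hSm n))]
  set A := B ∩ S n with hA
  have hAm : MeasurableSet A := hB.inter (hSm n)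
  have h1 : μ.map (firstCoords k) A = μ.map (firstCoords k) (A ∩ pdSupport k) := by
    rw [Measure.map_apply (measurable_firstCoords k) hAm,
      Measure.map_apply (measurable_firstCoords k) (hAm.inter hU)]
    refine measure_congr ?_
    filter_upwards [hμ] with x hx
    exact propext ⟨fun h => ⟨h, firstCoords_mem_pdSupport hx k⟩, fun h => h.1⟩
  have h2 : ∫⁻ t in A, ENNReal.ofReal (pdDensity k t) =
      ∫⁻ t in A ∩ pdSupport k, ENNReal.ofReal (pdDensity k t) := by
    have h3 : (fun t => ENNReal.ofReal (pdDensity k t)) =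
        (pdSupport k).indicator fun t => ENNReal.ofReal (pdDensity k t) := by
      refine (Set.indicator_eq_self.mpr fun t ht => ?_).symm
      by_contra h
      exact ht (by simp only [pdDensity, if_neg h, ENNReal.ofReal_zero])
    conv_lhs => rw [h3]
    rw [lintegral_indicator hU, Measure.restrict_restrict hU, Set.inter_comm]
  rw [h1, h2]
  refine map_firstCoords_apply hμ hsb k n (hAm.inter hU) Set.inter_subset_right fun t ht => ?_
  exact ht.1.2.resolve_left fun h => h ht.2

/-! ### Uniqueness, compactness and convergence -/

/-- Every finite set of coordinates lies in an initial segment, so the densities fix all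
finite-dimensional marginals. -/
theorem IsPoissonDirichlet.unique {μ ν : ProbabilityMeasure (ℕ → ℝ)} (hμ : IsPoissonDirichlet μ)
    (hν : IsPoissonDirichlet ν) : ν = μ := by
  refine Subtype.ext ?_
  refine IsProjectiveLimit.unique (P := fun I => (μ : Measure (ℕ → ℝ)).map I.restrict)
    (fun I => ?_) fun I => rfl
  obtain ⟨k, hk⟩ := I.exists_nat_subset_range
  let g : (Fin (k + 1) → ℝ) → I → ℝ := fun t i =>
    t ⟨i, (Finset.mem_range.mp (hk i.2)).trans (Nat.lt_succ_self k)⟩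
  have hg : Measurable g := by fun_prop
  have hI : (I.restrict : (ℕ → ℝ) → I → ℝ) = g ∘ firstCoords k := rfl
  simp only
  rw [hI]
  change Measure.map (g ∘ firstCoords k) (ν : Measure (ℕ → ℝ)) =
    Measure.map (g ∘ firstCoords k) (μ : Measure (ℕ → ℝ))
  rw [← Measure.map_map hg (measurable_firstCoords k), hν.density k, ← hμ.density k,
    Measure.map_map hg (measurable_firstCoords k)]

theorem isClosed_sortedSimplex : IsClosed sortedSimplex := by
  have h : sortedSimplex = (⋂ i, ⋂ j, ⋂ (_ : i ≤ j), {x : ℕ → ℝ | x j ≤ x i}) ∩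
      ((⋂ i, {x | 0 ≤ x i}) ∩ ⋂ n, {x | ∑ i ∈ Finset.range n, x i ≤ 1}) := by
    ext x; simp [sortedSimplex, Antitone]
  rw [h]
  refine IsClosed.inter ?_ (IsClosed.inter ?_ ?_)
  · exact isClosed_iInter fun i => isClosed_iInter fun j => isClosed_iInter fun _ =>
      isClosed_le (continuous_apply j) (continuous_apply i)
  · exact isClosed_iInter fun i => isClosed_le continuous_const (continuous_apply i)
  · exact isClosed_iInter fun n => isClosed_le (by fun_prop) continuous_const

theorem isCompact_sortedSimplex : IsCompact sortedSimplex := by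
  refine (isCompact_univ_pi fun _ : ℕ => isCompact_Icc (a := (0 : ℝ)) (b := 1)).of_isClosed_subset
    isClosed_sortedSimplex fun x hx i _ => ⟨hx.2.1 i, ?_⟩
  exact (Finset.single_le_sum (fun j _ => hx.2.1 j) (Finset.self_mem_range_succ i)).trans
    (hx.2.2 (i + 1))

theorem ae_primeFactorLaw_mem_sortedSimplex (n : ℕ+) :
    ∀ᵐ x ∂(primeFactorLaw n : Measure (ℕ → ℝ)), x ∈ sortedSimplex := by
  rw [primeFactorLaw, ProbabilityMeasure.coe_mk, ae_map_iff (p := (· ∈ sortedSimplex))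
    Measurable.of_discrete.aemeasurable isClosed_sortedSimplex.measurableSet]
  have h : ∀ᵐ m ∂(uniformUpTo n), m ∈ Set.Icc 1 (n : ℕ) :=
    ae_cond_mem (Set.finite_Icc _ _).measurableSet
  filter_upwards [h] with m hm using logPrimeFactors_mem_sortedSimplex n hm

theorem isCompact_closure_range_primeFactorLaw :
    IsCompact (closure (Set.range primeFactorLaw)) := by
  refine isCompact_closure_of_isTightMeasureSet ?_
  rw [isTightMeasureSet_iff_exists_isCompact_measure_compl_le]
  refine fun ε _ => ⟨sortedSimplex, isCompact_sortedSimplex, ?_⟩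
  rintro _ ⟨_, ⟨n, rfl⟩, rfl⟩
  exact (ae_iff.mp (ae_primeFactorLaw_mem_sortedSimplex n)).trans_le zero_le

theorem ae_mem_sortedSimplex_of_tendsto {l : Filter ℕ+} [l.NeBot]
    {ν : ProbabilityMeasure (ℕ → ℝ)} (hν : Tendsto primeFactorLaw l (𝓝 ν)) :
    ∀ᵐ x ∂(ν : Measure (ℕ → ℝ)), x ∈ sortedSimplex := by
  have h1 := ProbabilityMeasure.limsup_measure_closed_le_of_tendsto hν isClosed_sortedSimplex
  have h2 : ∀ n : ℕ+, (primeFactorLaw n : Measure (ℕ → ℝ)) sortedSimplex = 1 := fun n =>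
    (prob_compl_eq_zero_iff isClosed_sortedSimplex.measurableSet).mp
      (ae_primeFactorLaw_mem_sortedSimplex n)
  simp only [h2, limsup_const] at h1
  exact (prob_compl_eq_zero_iff isClosed_sortedSimplex.measurableSet).mpr
    (le_antisymm prob_le_one h1)

theorem isPoissonDirichlet_of_tendsto {l : Filter ℕ+} [l.NeBot] (hl : l ≤ atTop)
    {ν : ProbabilityMeasure (ℕ → ℝ)} (hν : Tendsto primeFactorLaw l (𝓝 ν)) :
    IsPoissonDirichlet ν := by
  have hS := ae_mem_sortedSimplex_of_tendsto hν
  have hsb := sizeBiased_eq_restrict hS (restrict_le_sizeBiased hl hν hS)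
  have hstrict := ae_mem_strictSimplex hS hsb
  exact ⟨hstrict.mono fun x hx => ⟨fun i => (hx.2.1 i).le, hx.2.2⟩, map_firstCoords_eq hstrict hsb⟩

theorem exists_tendsto_primeFactorLaw {u : Ultrafilter ℕ+} :
    ∃ ν, Tendsto primeFactorLaw u (𝓝 ν) := by
  obtain ⟨ν, -, hν⟩ := isCompact_closure_range_primeFactorLaw.ultrafilter_le_nhds'
    (u.map primeFactorLaw) (Ultrafilter.mem_map.mpr
      (univ_mem' fun n => subset_closure (Set.mem_range_self n)))
  exact ⟨ν, hν⟩

end Billingsley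

theorem mainTheorem2 :
    ∃ μ : ProbabilityMeasure (ℕ → ℝ),
      Billingsley.IsPoissonDirichlet μ ∧
      (∀ ν : ProbabilityMeasure (ℕ → ℝ), Billingsley.IsPoissonDirichlet ν → ν = μ) ∧
      TendstoInDistribution (fun n : ℕ+ => Billingsley.logPrimeFactors n) atTop
        (id : (ℕ → ℝ) → (ℕ → ℝ)) Billingsley.uniformUpTo (μ : Measure (ℕ → ℝ)) ∧
      ∀ k : ℕ,
        TendstoInDistribution
          (fun (n : ℕ+) (m : ℕ) =>
            Billingsley.firstCoords k (Billingsley.logPrimeFactors n m)) atTop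
          (Billingsley.firstCoords k) Billingsley.uniformUpTo (μ : Measure (ℕ → ℝ)) := by
  obtain ⟨μ, hμ⟩ := Billingsley.exists_tendsto_primeFactorLaw (u := Ultrafilter.of atTop)
  have hPD := Billingsley.isPoissonDirichlet_of_tendsto (Ultrafilter.of_le atTop) hμ
  have hlim : Tendsto Billingsley.primeFactorLaw atTop (𝓝 μ) := by
    -- Each ultrafilter below `atTop` has some limit law, and uniqueness forces that limit to be
    -- `μ`.
    refine tendsto_iff_ultrafilter _ _ _ |>.mpr fun u hu => ?_
    obtain ⟨ν, hν⟩ := Billingsley.exists_tendsto_primeFactorLaw (u := u)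
    rwa [hPD.unique (Billingsley.isPoissonDirichlet_of_tendsto hu hν)] at hν
  have hdist : TendstoInDistribution (fun n : ℕ+ => Billingsley.logPrimeFactors n) atTop
      (id : (ℕ → ℝ) → (ℕ → ℝ)) Billingsley.uniformUpTo (μ : Measure (ℕ → ℝ)) := by
    refine ⟨fun n => Measurable.of_discrete.aemeasurable, aemeasurable_id, ?_⟩
    have hid : (⟨(μ : Measure (ℕ → ℝ)).map id,
        Measure.isProbabilityMeasure_map aemeasurable_id⟩ : ProbabilityMeasure (ℕ → ℝ)) = μ :=
      Subtype.ext Measure.map_id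
    rw [hid]
    exact hlim
  exact ⟨μ, hPD, fun ν hν => hPD.unique hν, hdist, fun k =>
    hdist.continuous_comp (Billingsley.continuous_firstCoords k)⟩
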